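/- Let $G$ be a finite-dimensional Lie group with a basis $E_1,\dots,E_N$ of its Lie algebra, acting smoothly on $\mathbb{R}^n$ with unit Jacobian: $\Delta(g)=|\det D(\mathbf{x}\mapsto g\cdot\mathbf{x})|=1$ for all $g\in G$ and at all points of $\mathbb{R}^n$. For $v$ in the Lie algebra let $v\cdot\mathbf{y}$ be the infinitesimal action, i.e. the derivative at the identity of $g\mapsto g\cdot\mathbf{y}$ in the direction $v$. Let $h:\mathbb{R}^n\times[0,1]\to\mathbb{R}$ be differentiable, and put, for $s\in[0,1]$, $$M_{ij}(s)=\int_{\mathbb{R}^n}(\nabla h^T(E_i\cdot\mathbf{y}))(\nabla h^T(E_j\cdot\mathbf{y}))\,d\mathbf{y},\quad b_i(s)=\int_{\mathbb{R}^n}(\nabla h^T(E_i\cdot\mathbf{y}))\,\frac{\partial h}{\partial s}\,d\mathbf{y},\quad c(s)=\int_{\mathbb{R}^n}\Big(\frac{\partial h}{\partial s}\Big)^2d\mathbf{y},$$ where $h$ and its derivatives are evaluated at $(\mathbf{y},s)$ and the functions $\nabla h^T(E_i\cdot\mathbf{y})$ and $\partial h/\partial s$ are assumed to be square integrable over $\mathbb{R}^n$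 for each $s$. Fix $r\in\{1,2,\dots,\infty\}$ and suppose that $M$, $\mathbf{b}$, $c$ are of class $C^r$ on $[0,1]$, that $M(s)$ is invertible for all $s$, and that $$\mathfrak{g}_2(s)=\tfrac12\big(c(s)-\mathbf{b}(s)^TM(s)^{-1}\mathbf{b}(s)\big)>0\quad\text{for all } s\in[0,1].$$ Let $\mathcal{T}$ be the group of increasing $C^r$ bijections $\tau$ of $[0,1]$ with $C^r$ inverse (so $\tau(0)=0$, $\tau(1)=1$), and let $\mathcal{C}$ be the set of $C^r$ curves $g:[0,1]\to G$, with free boundary conditions. For $g\in\mathcal{C}$ and $\tau\in\mathcal{T}$ put $$C_2(g,\tau)=\frac12\int_0^1\int_{\mathbb{R}^n}\Big|\frac{d}{dt}h(g(t)^{-1}\cdot\mathbf{x},\tau(t))\Big|^2d\mathbf{x}\,dt,\qquad C_1(g)=\frac12\int_0^1\int_{\mathbb{R}^n}\Big|\frac{d}{dt}h(g(t)^{-1}\cdot\mathbf{x},t)\Big|^2d\mathbf{x}\,dt,\qquad J(\tau)=\int_0^1\dot\tau(t)^2\,\mathfrak{g}_2(\tau(t))\,dt.$$ Then globally minimizing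 $C_2$ over $\mathcal{C}\times\mathcal{T}$ is equivalent to first globally minimizing $C_1$ over $\mathcal{C}$ and then globally minimizing $J$ over $\mathcal{T}$. That is: 1. A curve $g_1\in\mathcal{C}$ is a global minimizer of $C_1$ over $\mathcal{C}$ if and only if its body velocity $g_1^{-1}\dot g_1$ has the coordinates $\xi^*=M^{-1}\mathbf{b}$ on $[0,1]$; for each $g_0\in G$ there is exactly one such minimizer with $g_1(0)=g_0$. 2. For every global minimizer $g_1$ of $C_1$ and every $\tau\in\mathcal{T}$, $C_2(g_1\circ\tau,\tau)=J(\tau)$. 3. $J$ has exactly one global minimizer $\tau_2^*$ over $\mathcal{T}$, and $\tau_2^*$ is the only element of $\mathcal{T}$ that solves the Euler–Lagrange equation $\frac{d}{dt}\frac{\partial f}{\partial\dot x}=\frac{\partial f}{\partial x}$ of $f(x,\dot x)=\dot x^2\mathfrak{g}_2(x)$ on $[0,1]$. 4. A pair $(g,\tau)$ is a global minimizer of $C_2$ over $\mathcal{C}\times\mathcal{T}$ if and only if $\tau$ is the global minimizer of $J$ over $\mathcal{T}$ and $g=g_1\circ\tau$ for some global minimizer $g_1$ of $C_1$ over $\mathcal{C}$.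 -/

import Mathlib

open Set MeasureTheory
open scoped Manifold ContDiff Matrix ENNReal

noncomputable section

namespace Reparam

/-- `g⁻¹ ġ = ξ`: the curve `g` in the Lie group `G` has, at every time `t ∈ [0, 1]`, the velocity
`ġ(t) = g(t) ξ(t)`, where `ξ(t)` is in the Lie algebra (one-sided derivatives at `0` and `1`). -/
def HasBodyVelocity {V : Type*} [NormedAddCommGroup V] [NormedSpace ℝ V]
    {G : Type*} [TopologicalSpace G] [ChartedSpace V G] [Group G]
    (g : ℝ → G) (ξ : ℝ → GroupLieAlgebra 𝓘(ℝ, V) G) : Prop :=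
  ∀ t ∈ Icc (0 : ℝ) 1, HasMFDerivWithinAt 𝓘(ℝ, ℝ) 𝓘(ℝ, V) g (Icc (0 : ℝ) 1) t
    ((1 : ℝ →L[ℝ] ℝ).smulRight (mulInvariantVectorField (ξ t) (g t)))

/-- The infinitesimal action `v · y` of a Lie algebra element `v` at the point `y`:
the derivative at the identity, in direction `v`, of the orbit map `g ↦ g · y`. -/
def infAction {V : Type*} [NormedAddCommGroup V] [NormedSpace ℝ V]
    {G : Type*} [TopologicalSpace G] [ChartedSpace V G] [Group G]
    {n : ℕ} [MulAction G (EuclideanSpace ℝ (Fin n))]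
    (v : GroupLieAlgebra 𝓘(ℝ, V) G) (y : EuclideanSpace ℝ (Fin n)) : EuclideanSpace ℝ (Fin n) :=
  mfderiv 𝓘(ℝ, V) 𝓘(ℝ, EuclideanSpace ℝ (Fin n)) (fun g : G => g • y) 1 v

/-- The Jacobian determinant `Δ` of the transformation `y ↦ g · y`, at `y`. -/
def jacobian {G : Type*} [Group G] {n : ℕ} [MulAction G (EuclideanSpace ℝ (Fin n))]
    (g : G) (y : EuclideanSpace ℝ (Fin n)) : ℝ :=
  |(fderiv ℝ (fun z : EuclideanSpace ℝ (Fin n) => g • z) y).det|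

/-- The partial derivative `∂h/∂s (y, s)`, for `s ∈ [0, 1]`. -/
def timeDeriv {n : ℕ} (h : EuclideanSpace ℝ (Fin n) → ℝ → ℝ)
    (y : EuclideanSpace ℝ (Fin n)) (s : ℝ) : ℝ :=
  derivWithin (fun u => h y u) (Icc (0 : ℝ) 1) s

/-- `[(∇h)(y, s)]ᵀ (v · y)`, where the gradient is taken in the space variable. -/
def spaceDeriv {V : Type*} [NormedAddCommGroup V] [NormedSpace ℝ V]
    {G : Type*} [TopologicalSpace G] [ChartedSpace V G] [Group G]
    {n : ℕ} [MulAction G (EuclideanSpace ℝ (Fin n))]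
    (h : EuclideanSpace ℝ (Fin n) → ℝ → ℝ) (v : GroupLieAlgebra 𝓘(ℝ, V) G)
    (y : EuclideanSpace ℝ (Fin n)) (s : ℝ) : ℝ :=
  fderiv ℝ (fun z => h z s) y (infAction v y)

section Coefficients

variable {V : Type*} [NormedAddCommGroup V] [NormedSpace ℝ V]
  {G : Type*} [TopologicalSpace G] [ChartedSpace V G] [Group G]
  {n : ℕ} [MulAction G (EuclideanSpace ℝ (Fin n))] {N : ℕ}

/-- `M_{ij}(s) = ∫ [(∇h)ᵀ (E_i · y)] [(∇h)ᵀ (E_j · y)] dy`. -/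
def coeffM (h : EuclideanSpace ℝ (Fin n) → ℝ → ℝ)
    (E : Module.Basis (Fin N) ℝ (GroupLieAlgebra 𝓘(ℝ, V) G)) (s : ℝ) :
    Matrix (Fin N) (Fin N) ℝ :=
  Matrix.of fun i j => ∫ y, spaceDeriv h (E i) y s * spaceDeriv h (E j) y s

/-- `b_i(s) = ∫ [(∇h)ᵀ (E_i · y)] (∂h/∂s) dy`. -/
def coeffB (h : EuclideanSpace ℝ (Fin n) → ℝ → ℝ)
    (E : Module.Basis (Fin N) ℝ (GroupLieAlgebra 𝓘(ℝ, V) G)) (s : ℝ) : Fin N → ℝ :=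
  fun i => ∫ y, spaceDeriv h (E i) y s * timeDeriv h y s

/-- `c(s) = ∫ (∂h/∂s)² dy`. -/
def coeffC (h : EuclideanSpace ℝ (Fin n) → ℝ → ℝ) (s : ℝ) : ℝ :=
  ∫ y, timeDeriv h y s ^ 2

/-- The Lie algebra element with coordinate vector `ξ*(s) = M(s)⁻¹ b(s)` in the basis `E`. -/
def xiStar (h : EuclideanSpace ℝ (Fin n) → ℝ → ℝ)
    (E : Module.Basis (Fin N) ℝ (GroupLieAlgebra 𝓘(ℝ, V) G)) (s : ℝ) :
    GroupLieAlgebra 𝓘(ℝ, V) G :=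
  ∑ k, ((coeffM h E s)⁻¹ *ᵥ coeffB h E s) k • E k

/-- `𝔤₂(s) = ½ (c(s) - b(s)ᵀ M(s)⁻¹ b(s))`. -/
def frakG (h : EuclideanSpace ℝ (Fin n) → ℝ → ℝ)
    (E : Module.Basis (Fin N) ℝ (GroupLieAlgebra 𝓘(ℝ, V) G)) (s : ℝ) : ℝ :=
  (1 / 2) * (coeffC h s - coeffB h E s ⬝ᵥ ((coeffM h E s)⁻¹ *ᵥ coeffB h E s))

/-- The curves in `G` of class `C^r` on `[0, 1]`; their endpoints and velocities are free. -/
def groupCurves (V : Type*) [NormedAddCommGroup V] [NormedSpace ℝ V]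
    (G : Type*) [TopologicalSpace G] [ChartedSpace V G] (r : ℕ∞) : Set (ℝ → G) :=
  {g | ContMDiffOn 𝓘(ℝ, ℝ) 𝓘(ℝ, V) r g (Icc (0 : ℝ) 1)}

/-- The temporal reparameterization group: the increasing bijections of `[0, 1]`, of class `C^r`
together with their inverses. -/
def TRG (r : ℕ∞) : Set (ℝ → ℝ) :=
  {τ | ContDiffOn ℝ r τ (Icc (0 : ℝ) 1) ∧ StrictMonoOn τ (Icc (0 : ℝ) 1) ∧
    τ 0 = 0 ∧ τ 1 = 1 ∧ MapsTo τ (Icc (0 : ℝ) 1) (Icc (0 : ℝ) 1) ∧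
    ∃ σ : ℝ → ℝ, ContDiffOn ℝ r σ (Icc (0 : ℝ) 1) ∧
      MapsTo σ (Icc (0 : ℝ) 1) (Icc (0 : ℝ) 1) ∧
      InvOn σ τ (Icc (0 : ℝ) 1) (Icc (0 : ℝ) 1)}

/-- The joint cost `C₂ = ½ ∫₀¹ ∫ |d/dt h(g(t)⁻¹ · x, τ(t))|² dx dt`, with values in `[0, ∞]`. -/
def costC₂ (h : EuclideanSpace ℝ (Fin n) → ℝ → ℝ) (g : ℝ → G) (τ : ℝ → ℝ) : ℝ≥0∞ :=
  (1 / 2) * ∫⁻ t in Icc (0 : ℝ) 1, ∫⁻ x : EuclideanSpace ℝ (Fin n),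
    ENNReal.ofReal
      (|derivWithin (fun u => h ((g u)⁻¹ • x) (τ u)) (Icc (0 : ℝ) 1) t| ^ 2)

/-- The cost of the nuisance-group problem,
`C₁ = ½ ∫₀¹ ∫ |d/dt h(g(t)⁻¹ · x, t)|² dx dt`, with values in `[0, ∞]`. -/
def costC₁ (h : EuclideanSpace ℝ (Fin n) → ℝ → ℝ) (g : ℝ → G) : ℝ≥0∞ :=
  (1 / 2) * ∫⁻ t in Icc (0 : ℝ) 1, ∫⁻ x : EuclideanSpace ℝ (Fin n),
    ENNReal.ofReal
      (|derivWithin (fun u => h ((g u)⁻¹ • x) u) (Icc (0 : ℝ) 1) t| ^ 2)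

end Coefficients

/-- The functional `∫₀¹ f(x, ẋ) dt`. -/
def functional (f : ℝ → ℝ → ℝ) (x : ℝ → ℝ) : ℝ :=
  ∫ t in (0 : ℝ)..1, f (x t) (derivWithin x (Icc (0 : ℝ) 1) t)

/-- The Euler-Lagrange equation `d/dt (∂f/∂ẋ) = ∂f/∂x` on `[0, 1]`, for a curve with values
in `[0, 1]` and an integrand `f(x, ẋ)` defined for `x ∈ [0, 1]`. -/
def EulerLagrange (f : ℝ → ℝ → ℝ) (x : ℝ → ℝ) : Prop :=
  ∀ t ∈ Icc (0 : ℝ) 1,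
    HasDerivWithinAt
      (fun u => deriv (fun v => f (x u) v) (derivWithin x (Icc (0 : ℝ) 1) u))
      (derivWithin (fun y => f y (derivWithin x (Icc (0 : ℝ) 1) t)) (Icc (0 : ℝ) 1) (x t))
      (Icc (0 : ℝ) 1) t

/-- The integrand `f(x, ẋ) = ẋ² 𝔤(x)` of the temporal reparameterization problem. -/
def reparamIntegrand (𝔤 : ℝ → ℝ) (x v : ℝ) : ℝ := v ^ 2 * 𝔤 x

/-- `a` is a global minimizer of `F` over the set `S`. -/
def IsGlobalMinimizer {α β : Type*} [Preorder β] (F : α → β) (S : Set α) (a : α) : Prop :=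
  a ∈ S ∧ ∀ a' ∈ S, F a ≤ F a'

end Reparam

end

/-!
For a curve `g` in `G` with body velocity `ξ` (so `ġ = g ξ`) and a reparameterization `τ`, the
moving point `g(t)⁻¹ • x` has velocity `-ξ(t) · y` at `y = g(t)⁻¹ • x`. Hence

`d/dt h(g(t)⁻¹ • x, τ(t)) = -∇hᵀ(ξ(t) · y) + τ'(t) ∂h/∂s`,

and since the action preserves Lebesgue measure, the integral over `x` of its square is a quadratic
polynomial in the coordinates of `ξ(t)` with coefficients `M`, `b`, `c` taken at `τ(t)`. The Gram
matrix `M` is positive semidefinite and invertible, so completing the square writes this polynomial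
as `‖ξ - τ' ξ*(τ)‖²_M + 2 τ'² 𝔤₂(τ)` (`lintegral_rate`). Integrating over `t` gives
`C₂(g, τ) ≥ J(τ)`. As the body velocity of a `C¹` curve is continuous, equality holds exactly when
`ξ = τ' ξ*(τ)` at every time (`costC₂_bound`). The cost `C₁` is the case `τ = id`.

Curves with body velocity `ξ*` exist from every starting point, are unique, and are as smooth as
`ξ*` (`exists_curve`, `HasBodyVelocityOn.eqOn`, `HasBodyVelocityOn.contMDiffOn`). In a chart the
condition is an ordinary differential equation, and left translation lets local solutions be joined
to one on `[0, 1]`. If `g₁` has velocity `ξ*`, then `g₁ ∘ τ` has velocity `τ' ξ*(τ)`; so the lower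
bound is attained for every `τ`, and the joint problem splits into the two separate ones.

For `J`, the speed `v = √𝔤₂(τ) τ'` has integral `L = ∫₀¹ √𝔤₂` for every `τ`, so that
`J(τ) = ∫ v² = L² + ∫ (v - L)²`, which is least exactly when `v = L`. This determines `τ` as the
inverse of the normalized arc length function (`exists_constant_speed`). The Euler-Lagrange
equation is equivalent to `v` being constant, since it makes `v²` a first integral
(`eulerLagrange_iff_metricSpeed`).
-/

noncomputable section

/-! ### Left-invariant fields in charts -/

namespace Reparam

open Filter Topology

section LieGroupCurves

variable {V : Type*} [NormedAddCommGroup V] [NormedSpace ℝ V]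
  {G : Type*} [TopologicalSpace G] [ChartedSpace V G] [Group G]

/-- `HasBodyVelocity` on an arbitrary set of times: the derivative of `g` within `s` at `t ∈ s` is
the left translate of `ξ t` to `g t`. -/
def HasBodyVelocityOn (g : ℝ → G) (ξ : ℝ → GroupLieAlgebra 𝓘(ℝ, V) G) (s : Set ℝ) : Prop :=
  ∀ t ∈ s, HasMFDerivWithinAt 𝓘(ℝ, ℝ) 𝓘(ℝ, V) g s t
    ((1 : ℝ →L[ℝ] ℝ).smulRight (mulInvariantVectorField (ξ t) (g t)))

/-- The left-invariant vector fields read in the chart at `p`: at the chart coordinate `x` of a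
group element `q`, this is the linear map sending a Lie algebra element `v` to the coordinates
of `q v`. -/
def chartField (p : G) (x : V) : V →L[ℝ] V :=
  fderiv ℝ (fun w => extChartAt 𝓘(ℝ, V) p
    ((extChartAt 𝓘(ℝ, V) p).symm x * (extChartAt 𝓘(ℝ, V) (1 : G)).symm w))
    (extChartAt 𝓘(ℝ, V) (1 : G) 1)

theorem HasBodyVelocityOn.continuousOn {g : ℝ → G} {ξ : ℝ → GroupLieAlgebra 𝓘(ℝ, V) G}
    {s : Set ℝ} (hg : HasBodyVelocityOn g ξ s) : ContinuousOn g s :=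
  fun t ht => (hg t ht).continuousWithinAt

theorem HasBodyVelocityOn.congr {g : ℝ → G} {ξ η : ℝ → GroupLieAlgebra 𝓘(ℝ, V) G}
    {s : Set ℝ} (hg : HasBodyVelocityOn g ξ s) (h : ∀ t ∈ s, ξ t = η t) :
    HasBodyVelocityOn g η s := by
  intro t ht
  rw [← h t ht]
  exact hg t ht

theorem HasBodyVelocityOn.congr_curve {g k : ℝ → G} {ξ : ℝ → GroupLieAlgebra 𝓘(ℝ, V) G}
    {s : Set ℝ} (hg : HasBodyVelocityOn g ξ s) (h : EqOn k g s) :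
    HasBodyVelocityOn k ξ s := by
  intro t ht
  have := (hg t ht).congr_mono h (h ht) subset_rfl
  rw [← h ht] at this
  exact this

variable [LieGroup 𝓘(ℝ, V) ∞ G]

theorem comp_smulRight_one {E F : Type*} [NormedAddCommGroup E] [NormedSpace ℝ E]
    [NormedAddCommGroup F] [NormedSpace ℝ F] (L : E →L[ℝ] F) (w : E) :
    L.comp ((1 : ℝ →L[ℝ] ℝ).smulRight w) = (1 : ℝ →L[ℝ] ℝ).smulRight (L w) := by
  ext
  simp

theorem smulRight_one_eq_toSpanSingleton {E : Type*} [NormedAddCommGroup E] [NormedSpace ℝ E]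
    (w : E) : (1 : ℝ →L[ℝ] ℝ).smulRight w = ContinuousLinearMap.toSpanSingleton ℝ w := by
  ext
  simp

theorem isManifold_one_of_lieGroup (V : Type*) [NormedAddCommGroup V] [NormedSpace ℝ V]
    (G : Type*) [TopologicalSpace G] [ChartedSpace V G] [Group G] [LieGroup 𝓘(ℝ, V) ∞ G] :
    IsManifold 𝓘(ℝ, V) 1 G := by
  have : IsManifold 𝓘(ℝ, V) ∞ G := ContMDiffMul.toIsManifold
  exact IsManifold.of_le (n := ∞) (by simp)

theorem mdifferentiable_mul_left_const (q : G) :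
    MDifferentiable 𝓘(ℝ, V) 𝓘(ℝ, V) (fun b : G => q * b) :=
  (contMDiff_mul_left (I := 𝓘(ℝ, V)) (n := ∞) (a := q)).mdifferentiable (by simp)

/-- The chain rule for a map applied to left translates of a Lie algebra element. -/
theorem mfderiv_mulInvariantVectorField {E' : Type*} [NormedAddCommGroup E'] [NormedSpace ℝ E']
    {H' : Type*} [TopologicalSpace H'] {I' : ModelWithCorners ℝ E' H'}
    {M : Type*} [TopologicalSpace M] [ChartedSpace H' M] {f : G → M} {q : G}
    (hf : MDifferentiableAt 𝓘(ℝ, V) I' f q) (v : GroupLieAlgebra 𝓘(ℝ, V) G) :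
    (mfderiv 𝓘(ℝ, V) I' f q (mulInvariantVectorField v q) : E') =
      mfderiv 𝓘(ℝ, V) I' (fun b => f (q * b)) (1 : G) v := by
  have key : ∀ q' : G, q' = q →
      HasMFDerivAt 𝓘(ℝ, V) I' f q' (mfderiv 𝓘(ℝ, V) I' f q : V →L[ℝ] E') := by
    rintro q' rfl
    exact hf.hasMFDerivAt
  have h2 := (mdifferentiable_mul_left_const (V := V) q (1 : G)).hasMFDerivAt
  have h3 := ((key (q * 1) (mul_one q)).comp (1 : G) h2).mfderiv
  exact (congrArg (fun L : V →L[ℝ] E' => L v) h3).symm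

/-- The coordinates of `q v` in the chart at `p` are given by `chartField`. -/
theorem mfderiv_extChartAt_mulInvariantVectorField (p q : G)
    (hq : q ∈ (chartAt V p).source) (v : GroupLieAlgebra 𝓘(ℝ, V) G) :
    (mfderiv 𝓘(ℝ, V) 𝓘(ℝ, V) (extChartAt 𝓘(ℝ, V) p) q (mulInvariantVectorField v q) : V) =
      chartField p (extChartAt 𝓘(ℝ, V) p q) v := by
  have := isManifold_one_of_lieGroup V G
  rw [mfderiv_mulInvariantVectorField (mdifferentiableAt_extChartAt hq)]
  have hd : MDifferentiableAt 𝓘(ℝ, V) 𝓘(ℝ, V) (fun b => extChartAt 𝓘(ℝ, V) p (q * b)) (1 : G) :=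
    MDifferentiableAt.comp (1 : G) (by rw [mul_one]; exact mdifferentiableAt_extChartAt hq)
      (mdifferentiable_mul_left_const (V := V) q (1 : G))
  rw [hd.mfderiv]
  simp only [writtenInExtChartAt, extChartAt_model_space_eq_id, chartField,
    (extChartAt 𝓘(ℝ, V) p).left_inv (show q ∈ (extChartAt 𝓘(ℝ, V) p).source by
      rwa [extChartAt_source])]
  simp only [modelWithCornersSelf_coe, range_id, fderivWithin_univ]
  rfl

theorem contDiffOn_chartField (p : G) :
    ContDiffOn ℝ ∞ (chartField (V := V) p) (extChartAt 𝓘(ℝ, V) p).target := by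
  have hG : IsManifold 𝓘(ℝ, V) ∞ G := ContMDiffMul.toIsManifold
  have : ContMDiffMul 𝓘(ℝ, V) ∞ G := LieGroup.toContMDiffMul
  intro x hx
  apply ContDiffAt.contDiffWithinAt
  have h1 : ContMDiffAt 𝓘(ℝ, V) 𝓘(ℝ, V) ∞ (extChartAt 𝓘(ℝ, V) p).symm x :=
    (contMDiffOn_extChartAt_symm p).contMDiffAt ((isOpen_extChartAt_target p).mem_nhds hx)
  have h2 : ContMDiffAt 𝓘(ℝ, V) 𝓘(ℝ, V) ∞ (extChartAt 𝓘(ℝ, V) (1 : G)).symm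
      (extChartAt 𝓘(ℝ, V) (1 : G) 1) :=
    (contMDiffOn_extChartAt_symm (1 : G)).contMDiffAt
      ((isOpen_extChartAt_target (1 : G)).mem_nhds (mem_extChartAt_target (1 : G)))
  have h3 : ContMDiffAt 𝓘(ℝ, V × V) 𝓘(ℝ, V) ∞ (fun z : V × V =>
      (extChartAt 𝓘(ℝ, V) p).symm z.1 * (extChartAt 𝓘(ℝ, V) (1 : G)).symm z.2)
      (x, extChartAt 𝓘(ℝ, V) (1 : G) 1) := by
    exact ContMDiffAt.mul
      (ContMDiffAt.comp (x, extChartAt 𝓘(ℝ, V) (1 : G) 1) h1 contDiff_fst.contMDiff.contMDiffAt)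
      (ContMDiffAt.comp (x, extChartAt 𝓘(ℝ, V) (1 : G) 1) h2 contDiff_snd.contMDiff.contMDiffAt)
  have h4 : ContMDiffAt 𝓘(ℝ, V × V) 𝓘(ℝ, V) ∞ (fun z : V × V => extChartAt 𝓘(ℝ, V) p
      ((extChartAt 𝓘(ℝ, V) p).symm z.1 * (extChartAt 𝓘(ℝ, V) (1 : G)).symm z.2))
      (x, extChartAt 𝓘(ℝ, V) (1 : G) 1) := by
    refine ContMDiffAt.comp (x, extChartAt 𝓘(ℝ, V) (1 : G) 1)
      (contMDiffAt_extChartAt' ?_) h3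
    rw [extChartAt_to_inv, mul_one, ← extChartAt_source 𝓘(ℝ, V)]
    exact (extChartAt 𝓘(ℝ, V) p).map_target hx
  exact ContDiffAt.fderiv (f := fun y w => extChartAt 𝓘(ℝ, V) p
      ((extChartAt 𝓘(ℝ, V) p).symm y * (extChartAt 𝓘(ℝ, V) (1 : G)).symm w))
    (g := fun _ => extChartAt 𝓘(ℝ, V) (1 : G) 1) h4.contDiffAt contDiffAt_const (by simp)

/-- Left translation by `q` identifies the Lie algebra with the tangent space at `q`; its inverse
is the derivative of left translation by `q⁻¹`. -/
theorem mulInvariantVectorField_bijective (q : G) :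
    Function.Bijective
      (fun v : GroupLieAlgebra 𝓘(ℝ, V) G => (mulInvariantVectorField v q : V)) := by
  have h1 : ∀ v : GroupLieAlgebra 𝓘(ℝ, V) G,
      (mfderiv 𝓘(ℝ, V) 𝓘(ℝ, V) (fun b => q⁻¹ * b) q (mulInvariantVectorField v q) : V) = v := by
    intro v
    rw [mfderiv_mulInvariantVectorField (mdifferentiable_mul_left_const q⁻¹ q)]
    have key : ∀ f : G → G, f = id → (mfderiv 𝓘(ℝ, V) 𝓘(ℝ, V) f (1 : G) v : V) = v := by
      rintro f rfl
      exact congrArg (fun L : V →L[ℝ] V => L v) (mfderiv_id (I := 𝓘(ℝ, V)) (x := (1 : G)))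
    exact key _ (funext fun b => inv_mul_cancel_left q b)
  have h2 : ∀ w : V, (mulInvariantVectorField (I := 𝓘(ℝ, V)) (mfderiv 𝓘(ℝ, V) 𝓘(ℝ, V)
      (fun b => q⁻¹ * b) q w : V) q : V) = w := by
    intro w
    have key : ∀ q' : G, q' = 1 → HasMFDerivAt 𝓘(ℝ, V) 𝓘(ℝ, V) (fun b => q * b) q'
        (mfderiv 𝓘(ℝ, V) 𝓘(ℝ, V) (fun b => q * b) 1 : V →L[ℝ] V) := by
      rintro q' rfl
      exact (mdifferentiable_mul_left_const q 1).hasMFDerivAt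
    have h3 := ((key (q⁻¹ * q) (inv_mul_cancel q)).comp q
      (mdifferentiable_mul_left_const (V := V) q⁻¹ q).hasMFDerivAt).mfderiv
    have h4 : (fun b : G => q * b) ∘ (fun b => q⁻¹ * b) = id := by ext; simp
    rw [h4, mfderiv_id] at h3
    exact (congrArg (fun L : V →L[ℝ] V => L w) h3).symm
  exact ⟨fun v w hvw => by rw [← h1 v, ← h1 w]; exact congrArg _ hvw, fun w => ⟨_, h2 w⟩⟩

theorem HasBodyVelocityOn.const_mul {g : ℝ → G} {ξ : ℝ → GroupLieAlgebra 𝓘(ℝ, V) G}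
    {s : Set ℝ} (hg : HasBodyVelocityOn g ξ s) (k : G) :
    HasBodyVelocityOn (fun t => k * g t) ξ s := by
  intro t ht
  have h1 := (mdifferentiable_mul_left_const (V := V) k (g t)).hasMFDerivAt
  have h2 := mfderiv_mulInvariantVectorField (mdifferentiable_mul_left_const (V := V) k (g t)) (ξ t)
  have h3 := h1.comp_hasMFDerivWithinAt t (hg t ht)
  have h4 : (fun b : G => k * (g t * b)) = fun b => k * g t * b :=
    funext fun b => (mul_assoc k (g t) b).symm
  have h5 := h2.trans (congrArg (fun f : G → G => (mfderiv 𝓘(ℝ, V) 𝓘(ℝ, V) f (1 : G) (ξ t) : V)) h4)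
  exact h3.congr_mfderiv ((comp_smulRight_one (E := V) (F := V) _ _).trans
    (congrArg (fun w : V => (1 : ℝ →L[ℝ] ℝ).smulRight w) h5))

/-- A curve in `G` has velocity `g v` at time `t` exactly when its coordinates in the chart at `p`
satisfy the corresponding equation for `chartField`. -/
theorem hasMFDerivWithinAt_iff_chart {g : ℝ → G} {v : GroupLieAlgebra 𝓘(ℝ, V) G}
    {s : Set ℝ} {t : ℝ} (p : G) (hts : t ∈ s) (ht : g t ∈ (chartAt V p).source) :
    HasMFDerivWithinAt 𝓘(ℝ, ℝ) 𝓘(ℝ, V) g s t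
        ((1 : ℝ →L[ℝ] ℝ).smulRight (mulInvariantVectorField v (g t))) ↔
      ContinuousWithinAt g s t ∧ HasDerivWithinAt (fun u => extChartAt 𝓘(ℝ, V) p (g u))
        (chartField p (extChartAt 𝓘(ℝ, V) p (g t)) v) s t := by
  have := isManifold_one_of_lieGroup V G
  have ht' : g t ∈ (extChartAt 𝓘(ℝ, V) p).source := by rwa [extChartAt_source]
  have hv := mfderiv_extChartAt_mulInvariantVectorField p (g t) ht v
  constructor
  · intro h
    refine ⟨h.continuousWithinAt, ?_⟩
    have h1 := (mdifferentiableAt_extChartAt (I := 𝓘(ℝ, V)) ht).hasMFDerivAt.comp_hasMFDerivWithinAt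
      t h
    have h2 := hasMFDerivWithinAt_iff_hasFDerivWithinAt.1 h1
    exact HasFDerivWithinAt.congr_fderiv h2 ((comp_smulRight_one (E := V) (F := V) _ _).trans
      ((congrArg (fun w : V => (1 : ℝ →L[ℝ] ℝ).smulRight w) hv).trans
        (smulRight_one_eq_toSpanSingleton _)))
  · rintro ⟨hc, h⟩
    have h0 : HasMFDerivAt 𝓘(ℝ, V) 𝓘(ℝ, V) (extChartAt 𝓘(ℝ, V) p).symm
        (extChartAt 𝓘(ℝ, V) p (g t))
        (mfderivWithin 𝓘(ℝ, V) 𝓘(ℝ, V) (extChartAt 𝓘(ℝ, V) p).symm (range 𝓘(ℝ, V))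
          (extChartAt 𝓘(ℝ, V) p (g t))) :=
      (mdifferentiableWithinAt_extChartAt_symm
        ((extChartAt 𝓘(ℝ, V) p).map_source ht')).hasMFDerivWithinAt.hasMFDerivAt (by simp)
    have h1 := h0.comp_hasMFDerivWithinAt t (hasMFDerivWithinAt_iff_hasFDerivWithinAt.2
      h.hasFDerivWithinAt)
    have h2 : g =ᶠ[𝓝[s] t] (extChartAt 𝓘(ℝ, V) p).symm ∘ fun u => extChartAt 𝓘(ℝ, V) p (g u) := by
      filter_upwards [hc.preimage_mem_nhdsWithin
        ((isOpen_extChartAt_source (I := 𝓘(ℝ, V)) p).mem_nhds ht')] with u hu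
      exact ((extChartAt 𝓘(ℝ, V) p).left_inv hu).symm
    have hc1 : ((mfderivWithin 𝓘(ℝ, V) 𝓘(ℝ, V) (extChartAt 𝓘(ℝ, V) p).symm (range 𝓘(ℝ, V))
          (extChartAt 𝓘(ℝ, V) p (g t)) : V →L[ℝ] V).comp
        (ContinuousLinearMap.toSpanSingleton ℝ (chartField p (extChartAt 𝓘(ℝ, V) p (g t)) v)))
        = (1 : ℝ →L[ℝ] ℝ).smulRight (mulInvariantVectorField v (g t) : V) := by
      have gen : ∀ (L A : V →L[ℝ] V) (w c : V), A w = c → L.comp A = ContinuousLinearMap.id ℝ V →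
          L.comp (ContinuousLinearMap.toSpanSingleton ℝ c) = (1 : ℝ →L[ℝ] ℝ).smulRight w := by
        rintro L A w c rfl h
        rw [← smulRight_one_eq_toSpanSingleton, comp_smulRight_one]
        exact congrArg (fun B : V →L[ℝ] V => (1 : ℝ →L[ℝ] ℝ).smulRight (B w)) h
      exact gen _ _ _ _ hv
        (mfderivWithin_extChartAt_symm_comp_mfderiv_extChartAt' (I := 𝓘(ℝ, V)) ht')
    have h4 := h1.congr_of_eventuallyEq h2 (h2.self_of_nhdsWithin hts)
    have key : ∀ L : ℝ →L[ℝ] V, L = (1 : ℝ →L[ℝ] ℝ).smulRight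
        (mulInvariantVectorField v (g t) : V) → HasMFDerivWithinAt 𝓘(ℝ, ℝ) 𝓘(ℝ, V) g s t L →
        HasMFDerivWithinAt 𝓘(ℝ, ℝ) 𝓘(ℝ, V) g s t
          ((1 : ℝ →L[ℝ] ℝ).smulRight (mulInvariantVectorField v (g t))) := by
      rintro L rfl h
      exact h
    exact key _ hc1 h4

end LieGroupCurves

end Reparam

/-! ### Curves with a given body velocity -/

namespace Reparam

open Filter Topology NNReal

section CurvesWithGivenVelocity

variable {V : Type*} [NormedAddCommGroup V] [NormedSpace ℝ V]
  {G : Type*} [TopologicalSpace G] [ChartedSpace V G] [Group G]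

theorem HasBodyVelocityOn.mono {g : ℝ → G} {ξ : ℝ → GroupLieAlgebra 𝓘(ℝ, V) G}
    {s s' : Set ℝ} (hg : HasBodyVelocityOn g ξ s) (hs : s' ⊆ s) : HasBodyVelocityOn g ξ s' :=
  fun t ht => (hg t (hs ht)).mono hs

/-- Two curves with the same velocity that meet at time `b` can be joined there. -/
theorem HasBodyVelocityOn.glue {g k : ℝ → G} {ξ : ℝ → GroupLieAlgebra 𝓘(ℝ, V) G} {a b c : ℝ}
    (hab : a ≤ b) (hbc : b ≤ c) (hg : HasBodyVelocityOn g ξ (Icc a b))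
    (hk : HasBodyVelocityOn k ξ (Icc b c)) (h : g b = k b) :
    HasBodyVelocityOn (fun u => if u ≤ b then g u else k u) ξ (Icc a c) := by
  set f : ℝ → G := fun u => if u ≤ b then g u else k u with hf
  have e1 : EqOn f g (Icc a b) := fun u hu => if_pos hu.2
  have e2 : EqOn f k (Icc b c) := by
    intro u hu
    rcases hu.1.eq_or_lt with rfl | hlt
    · simpa [hf] using h
    · exact if_neg (not_le.2 hlt)
  have h1 := hg.congr_curve e1
  have h2 := hk.congr_curve e2
  intro t ht
  rcases lt_trichotomy t b with hlt | rfl | hlt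
  · refine (h1 t ⟨ht.1, hlt.le⟩).mono_of_mem_nhdsWithin ?_
    filter_upwards [self_mem_nhdsWithin, mem_nhdsWithin_of_mem_nhds (Iio_mem_nhds hlt)] with u hu hu'
    exact ⟨hu.1, le_of_lt hu'⟩
  · rw [← Icc_union_Icc_eq_Icc hab hbc]
    exact (h1 t ⟨hab, le_rfl⟩).union (h2 t ⟨le_rfl, hbc⟩)
  · refine (h2 t ⟨hlt.le, ht.2⟩).mono_of_mem_nhdsWithin ?_
    filter_upwards [self_mem_nhdsWithin, mem_nhdsWithin_of_mem_nhds (Ioi_mem_nhds hlt)] with u hu hu'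
    exact ⟨le_of_lt hu', hu.2⟩

/-- The velocity of a reparameterized curve. -/
theorem HasBodyVelocityOn.comp_real {g : ℝ → G} {ξ : ℝ → GroupLieAlgebra 𝓘(ℝ, V) G}
    {s s' : Set ℝ} (hg : HasBodyVelocityOn g ξ s) {τ τ' : ℝ → ℝ} (hτ : MapsTo τ s' s)
    (hτ' : ∀ t ∈ s', HasDerivWithinAt τ (τ' t) s' t) :
    HasBodyVelocityOn (g ∘ τ) (fun t => τ' t • ξ (τ t)) s' := by
  intro t ht
  have h1 := (hg (τ t) (hτ ht)).comp t
    (hasMFDerivWithinAt_iff_hasFDerivWithinAt.2 (hτ' t ht).hasFDerivWithinAt) hτ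
  refine h1.congr_mfderiv ?_
  -- the tangent spaces of `G` are `V` by definition; in `V` the identity of linear maps is plain
  have gen : ∀ (L : V →L[ℝ] V) (v : V) (c : ℝ), ((1 : ℝ →L[ℝ] ℝ).smulRight (L v)).comp
      (ContinuousLinearMap.toSpanSingleton ℝ c) = (1 : ℝ →L[ℝ] ℝ).smulRight (L (c • v)) := by
    intro L v c
    ext
    simp
  exact gen (mfderiv 𝓘(ℝ, V) 𝓘(ℝ, V) (fun b => g (τ t) * b) (1 : G)) (ξ (τ t)) (τ' t)

/-- Near any time of its interval of definition, a continuous curve stays in the chart at its current position on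
a closed subinterval. -/
theorem exists_Icc_mapsTo_chart_source {V : Type*} [NormedAddCommGroup V]
    {G : Type*} [TopologicalSpace G] [ChartedSpace V G] {g : ℝ → G} {a b t₀ : ℝ} (hg : ContinuousOn g (Icc a b))
    (ht₀ : t₀ ∈ Icc a b) : ∃ ε > 0, ∀ u ∈ Icc a b, u ∈ Icc (t₀ - ε) (t₀ + ε) →
      g u ∈ (chartAt V (g t₀)).source := by
  have h1 := (hg t₀ ht₀).preimage_mem_nhdsWithin
    ((chartAt V (g t₀)).open_source.mem_nhds (mem_chart_source V (g t₀)))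
  obtain ⟨ε, hε, h2⟩ := Metric.mem_nhdsWithin_iff.1 h1
  refine ⟨ε / 2, by positivity, fun u hu hu' => h2 ⟨?_, hu⟩⟩
  rw [Metric.mem_ball, Real.dist_eq, abs_lt]
  constructor <;> linarith [hu'.1, hu'.2]

variable [LieGroup 𝓘(ℝ, V) ∞ G]

/-- A curve whose body velocity is of class `C^r` is itself of class `C^r`. -/
theorem HasBodyVelocityOn.contMDiffOn [CompleteSpace V] {g : ℝ → G} {ξ : ℝ → V} {a b : ℝ} {r : ℕ∞}
    (hg : HasBodyVelocityOn (V := V) g ξ (Icc a b)) (hξ : ContDiffOn ℝ r ξ (Icc a b)) :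
    ContMDiffOn 𝓘(ℝ, ℝ) 𝓘(ℝ, V) r g (Icc a b) := by
  intro t₀ ht₀
  obtain ⟨ε, hε, hsrc⟩ := exists_Icc_mapsTo_chart_source (V := V) hg.continuousOn ht₀
  set p := g t₀
  set a' := max a (t₀ - ε)
  set b' := min b (t₀ + ε)
  have hsub : Icc a' b' ⊆ Icc a b := Icc_subset_Icc (le_max_left _ _) (min_le_left _ _)
  have hsub' : Icc a' b' ⊆ Icc (t₀ - ε) (t₀ + ε) :=
    Icc_subset_Icc (le_max_right _ _) (min_le_right _ _)
  have hnhds : Icc a' b' ∈ 𝓝[Icc a b] t₀ := by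
    filter_upwards [self_mem_nhdsWithin, mem_nhdsWithin_of_mem_nhds
      (Icc_mem_nhds (show t₀ - ε < t₀ by linarith) (show t₀ < t₀ + ε by linarith))] with u hu hu'
    exact ⟨max_le hu.1 hu'.1, le_min hu.2 hu'.2⟩
  have hmem : ∀ u ∈ Icc a' b', g u ∈ (chartAt V p).source :=
    fun u hu => hsrc u (hsub hu) (hsub' hu)
  have hF : ContDiffOn ℝ r (Function.uncurry fun (t : ℝ) (x : V) => chartField p x (ξ t))
      (Icc a' b' ×ˢ (extChartAt 𝓘(ℝ, V) p).target) :=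
    (((contDiffOn_chartField p).of_le (by exact_mod_cast le_top)).comp contDiffOn_snd
      (fun z hz => hz.2)).clm_apply ((hξ.mono hsub).comp contDiffOn_fst (fun z hz => hz.1))
  have hx : ContDiffOn ℝ r (fun u => extChartAt 𝓘(ℝ, V) p (g u)) (Icc a' b') := by
    refine ODE.contDiffOn_enat_Icc_of_hasDerivWithinAt hF (fun t ht => ?_) (fun t ht => ?_)
    · exact (((hasMFDerivWithinAt_iff_chart p (hsub ht) (hmem t ht)).1 (hg t (hsub ht))).2).mono hsub
    · exact (extChartAt 𝓘(ℝ, V) p).map_source (by rw [extChartAt_source]; exact hmem t ht)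
  have ht₀' : t₀ ∈ Icc a' b' := mem_of_mem_nhdsWithin ht₀ hnhds
  refine ContMDiffWithinAt.mono_of_mem_nhdsWithin ?_ hnhds
  exact contMDiffWithinAt_iff_target.2 ⟨(hg.continuousOn t₀ ht₀).mono hsub,
    (hx t₀ ht₀').contMDiffWithinAt⟩

theorem chartField_bijective (p q : G) (hq : q ∈ (chartAt V p).source) :
    Function.Bijective (chartField (V := V) p (extChartAt 𝓘(ℝ, V) p q)) := by
  have := isManifold_one_of_lieGroup V G
  have h1 : Function.Bijective
      (mfderiv 𝓘(ℝ, V) 𝓘(ℝ, V) (extChartAt 𝓘(ℝ, V) p) q : V →L[ℝ] V) := by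
    obtain ⟨e, he⟩ : ∃ e : V ≃L[ℝ] V,
        (e : V →L[ℝ] V) = mfderiv 𝓘(ℝ, V) 𝓘(ℝ, V) (extChartAt 𝓘(ℝ, V) p) q :=
      isInvertible_mfderiv_extChartAt (I := 𝓘(ℝ, V)) (x := p) (y := q)
        (by rwa [extChartAt_source])
    rw [← he]
    exact e.bijective
  have h2 := h1.comp (mulInvariantVectorField_bijective (V := V) q)
  have h3 : (chartField (V := V) p (extChartAt 𝓘(ℝ, V) p q) : V → V) =
      (mfderiv 𝓘(ℝ, V) 𝓘(ℝ, V) (extChartAt 𝓘(ℝ, V) p) q : V →L[ℝ] V) ∘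
        (fun v : GroupLieAlgebra 𝓘(ℝ, V) G => (mulInvariantVectorField v q : V)) :=
    funext fun v => (mfderiv_extChartAt_mulInvariantVectorField p q hq v).symm
  rw [h3]
  exact h2

/-- A `C¹` curve has a continuous body velocity. -/
theorem exists_continuous_bodyVelocity [FiniteDimensional ℝ V] {g : ℝ → G}
    (hg : ContMDiffOn 𝓘(ℝ, ℝ) 𝓘(ℝ, V) 1 g (Icc (0 : ℝ) 1)) :
    ∃ ξ : ℝ → V, ContinuousOn ξ (Icc 0 1) ∧ HasBodyVelocityOn (V := V) g ξ (Icc 0 1) := by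
  have hu := uniqueDiffOn_Icc (zero_lt_one (α := ℝ))
  choose ξ hξ using fun t => (mulInvariantVectorField_bijective (V := V) (g t)).surjective
    (mfderivWithin 𝓘(ℝ, ℝ) 𝓘(ℝ, V) g (Icc (0 : ℝ) 1) t (1 : ℝ))
  have hvel : HasBodyVelocityOn (V := V) g ξ (Icc 0 1) := by
    intro t ht
    have h1 := ((hg t ht).mdifferentiableWithinAt (by simp)).hasMFDerivWithinAt
    refine h1.congr_mfderiv ?_
    have gen : ∀ (L : ℝ →L[ℝ] V) (w : V), w = L 1 → L = (1 : ℝ →L[ℝ] ℝ).smulRight w := by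
      rintro L w rfl
      ext
      simp
    exact gen _ _ (hξ t)
  refine ⟨ξ, fun t₀ ht₀ => ?_, hvel⟩
  set p := g t₀
  have hev : ∀ᶠ t in 𝓝[Icc (0 : ℝ) 1] t₀, t ∈ Icc (0 : ℝ) 1 ∧ g t ∈ (chartAt V p).source :=
    eventually_mem_nhdsWithin.and ((hg.continuousOn t₀ ht₀).preimage_mem_nhdsWithin
      ((chartAt V p).open_source.mem_nhds (mem_chart_source V p)))
  have hx : ContDiffWithinAt ℝ 1 (fun u => extChartAt 𝓘(ℝ, V) p (g u)) (Icc (0 : ℝ) 1) t₀ :=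
    (contMDiffWithinAt_iff_target.1 (hg t₀ ht₀)).2.contDiffWithinAt
  have hx' : ContinuousWithinAt (fun t => derivWithin (fun u => extChartAt 𝓘(ℝ, V) p (g u))
      (Icc (0 : ℝ) 1) t) (Icc (0 : ℝ) 1) t₀ := by
    have := (hx.fderivWithin_right (m := 0) hu (by simp) ht₀).continuousWithinAt
    exact this.clm_apply continuousWithinAt_const
  have hinv : ∀ q ∈ (chartAt V p).source, ∃ e : V ≃L[ℝ] V,
      (e : V →L[ℝ] V) = chartField p (extChartAt 𝓘(ℝ, V) p q) := by
    intro q hq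
    refine ⟨(LinearEquiv.ofBijective _ (chartField_bijective p q hq)).toContinuousLinearEquiv, ?_⟩
    ext v
    rfl
  have hL : ContinuousWithinAt (fun t => chartField (V := V) p (extChartAt 𝓘(ℝ, V) p (g t)))
      (Icc (0 : ℝ) 1) t₀ := by
    have h1 : ContinuousAt (chartField (V := V) p) (extChartAt 𝓘(ℝ, V) p p) :=
      (contDiffOn_chartField p).continuousOn.continuousAt
        (extChartAt_target_mem_nhds p)
    exact ContinuousAt.comp_continuousWithinAt (f := fun u => extChartAt 𝓘(ℝ, V) p (g u))
      h1 hx.continuousWithinAt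
  have hLi : ContinuousWithinAt (fun t => ContinuousLinearMap.inverse
      (chartField (V := V) p (extChartAt 𝓘(ℝ, V) p (g t)))) (Icc (0 : ℝ) 1) t₀ := by
    refine ContinuousAt.comp_continuousWithinAt (g := fun L : V →L[ℝ] V => L.inverse) ?_ hL
    obtain ⟨e, he⟩ := hinv p (mem_chart_source V p)
    have : CompleteSpace V := FiniteDimensional.complete ℝ V
    change ContinuousAt (fun L : V →L[ℝ] V => L.inverse)
      (chartField (V := V) p (extChartAt 𝓘(ℝ, V) p p))
    rw [← he]
    exact (contDiffAt_map_inverse (𝕜 := ℝ) (n := 0) e).continuousAt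
  refine ContinuousWithinAt.congr_of_eventuallyEq_of_mem (hLi.clm_apply hx') ?_ ht₀
  filter_upwards [hev] with t ht
  obtain ⟨e, he⟩ := hinv (g t) ht.2
  have h2 := ((hasMFDerivWithinAt_iff_chart p ht.1 ht.2).1 (hvel t ht.1)).2.derivWithin
    (hu t ht.1)
  rw [h2, ← he, ContinuousLinearMap.inverse_equiv]
  exact (e.symm_apply_apply _).symm

end CurvesWithGivenVelocity

end Reparam

/-! ### Existence and uniqueness of curves with a given body velocity -/

namespace Reparam

open Filter Topology NNReal

section ExistenceUniqueness

/-- Local solutions of `x' = F(x) ξ(t)` for a locally Lipschitz operator field `F` and continuous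
controls `ξ`. -/
theorem exists_local_solution {V : Type*} [NormedAddCommGroup V] [NormedSpace ℝ V]
    [CompleteSpace V] {F : V → V →L[ℝ] V} {x₀ : V} (hF : ContDiffAt ℝ 1 F x₀) {ξ : ℝ → V}
    (hξ : Continuous ξ) (t₀ : ℝ) :
    ∃ ε > 0, ∃ x : ℝ → V, x t₀ = x₀ ∧ ∀ t ∈ Icc (t₀ - ε) (t₀ + ε),
      HasDerivWithinAt x (F (x t) (ξ t)) (Icc (t₀ - ε) (t₀ + ε)) t := by
  obtain ⟨K, s, hs, hlip⟩ := hF.exists_lipschitzOnWith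
  obtain ⟨δ, hδ, hball⟩ := Metric.nhds_basis_closedBall.mem_iff.1 hs
  obtain ⟨C, hC⟩ := (isCompact_Icc (a := t₀ - 1) (b := t₀ + 1)).exists_bound_of_continuousOn
    hξ.continuousOn
  have hC0 : 0 ≤ C := (norm_nonneg _).trans (hC t₀ ⟨by linarith, by linarith⟩)
  set a : ℝ≥0 := ⟨δ, hδ.le⟩
  set B : ℝ := ‖F x₀‖ + K * δ
  have hB : 0 ≤ B := by positivity
  set L : ℝ≥0 := ⟨B * C + 1, by positivity⟩
  have hL : (0 : ℝ) < L := by change 0 < B * C + 1; positivity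
  set ε : ℝ := min 1 (δ / L)
  have hε : 0 < ε := lt_min one_pos (div_pos hδ hL)
  have hsub : Icc (t₀ - ε) (t₀ + ε) ⊆ Icc (t₀ - 1) (t₀ + 1) :=
    Icc_subset_Icc (by linarith [min_le_left 1 (δ / L)]) (by linarith [min_le_left 1 (δ / L)])
  have hlip' : LipschitzOnWith K F (Metric.closedBall x₀ δ) := hlip.mono hball
  have hpl : IsPicardLindelof (fun t x => F x (ξ t))
      (⟨t₀, by constructor <;> linarith⟩ : Icc (t₀ - ε) (t₀ + ε)) x₀ a 0 L
      (K * C.toNNReal) := by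
    refine ⟨fun t ht => ?_, fun x _ => ?_, fun t ht x hx => ?_, ?_⟩
    · refine LipschitzOnWith.of_dist_le_mul fun x hx y hy => ?_
      rw [dist_eq_norm, ← sub_apply]
      refine (ContinuousLinearMap.le_opNorm _ _).trans ?_
      have h1 := hlip'.dist_le_mul x hx y hy
      rw [dist_eq_norm] at h1
      have h2 := hC t (hsub ht)
      calc ‖F x - F y‖ * ‖ξ t‖ ≤ (K * dist x y) * C := by gcongr
        _ = _ := by rw [NNReal.coe_mul, Real.coe_toNNReal C hC0]; ring
    · exact (continuous_const.clm_apply hξ).continuousOn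
    · have h1 := hlip'.dist_le_mul x hx x₀ (Metric.mem_closedBall_self hδ.le)
      have h2 : dist x x₀ ≤ δ := hx
      have h3 : ‖F x‖ ≤ B := by
        have h4 : ‖F x‖ ≤ ‖F x₀‖ + ‖F x - F x₀‖ := by
          simpa using norm_add_le (F x₀) (F x - F x₀)
        rw [dist_eq_norm] at h1
        have h5 : (K : ℝ) * dist x x₀ ≤ K * δ := by gcongr
        linarith
      refine (ContinuousLinearMap.le_opNorm _ _).trans ?_
      calc ‖F x‖ * ‖ξ t‖ ≤ B * C := by
            gcongr
            exact hC t (hsub ht)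
        _ ≤ B * C + 1 := by linarith
    · have h1 : max (t₀ + ε - t₀) (t₀ - (t₀ - ε)) = ε := by simp
      change (L : ℝ) * max (t₀ + ε - t₀) (t₀ - (t₀ - ε)) ≤ δ - 0
      rw [h1, sub_zero, mul_comm]
      exact (le_div_iff₀ hL).1 (min_le_right _ _)
  obtain ⟨x, hx0, hx⟩ := hpl.exists_eq_forall_mem_Icc_hasDerivWithinAt₀
  exact ⟨ε, hε, x, hx0, hx⟩

variable {V : Type*} [NormedAddCommGroup V] [NormedSpace ℝ V]
  {G : Type*} [TopologicalSpace G] [ChartedSpace V G] [Group G] [LieGroup 𝓘(ℝ, V) ∞ G]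

theorem exists_local_curve (G : Type*) [TopologicalSpace G] [ChartedSpace V G] [Group G]
    [LieGroup 𝓘(ℝ, V) ∞ G] [CompleteSpace V] {ξ : ℝ → V} (hξ : Continuous ξ) (t₀ : ℝ) :
    ∃ ε > 0, ∃ g : ℝ → G, HasBodyVelocityOn (V := V) g ξ (Icc (t₀ - ε) (t₀ + ε)) := by
  set p : G := 1
  set φ := extChartAt 𝓘(ℝ, V) p
  have hT : φ.target ∈ 𝓝 (φ p) := extChartAt_target_mem_nhds p
  obtain ⟨ε, hε, x, hx0, hx⟩ := exists_local_solution
    (((contDiffOn_chartField (V := V) p).contDiffAt hT).of_le (by simp)) hξ t₀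
  have ht₀ : t₀ ∈ Icc (t₀ - ε) (t₀ + ε) := ⟨by linarith, by linarith⟩
  have hcont : ContinuousAt x t₀ := (hx t₀ ht₀).continuousWithinAt.continuousAt
    (Icc_mem_nhds (by linarith) (by linarith))
  obtain ⟨δ, hδ, hball⟩ := Metric.nhds_basis_closedBall.mem_iff.1
    (hcont.preimage_mem_nhds (by rw [hx0]; exact hT))
  rw [Real.closedBall_eq_Icc] at hball
  set η := min ε δ
  have hη : 0 < η := lt_min hε hδ
  have hs1 : Icc (t₀ - η) (t₀ + η) ⊆ Icc (t₀ - ε) (t₀ + ε) :=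
    Icc_subset_Icc (by linarith [min_le_left ε δ]) (by linarith [min_le_left ε δ])
  have hs2 : Icc (t₀ - η) (t₀ + η) ⊆ Icc (t₀ - δ) (t₀ + δ) :=
    Icc_subset_Icc (by linarith [min_le_right ε δ]) (by linarith [min_le_right ε δ])
  refine ⟨η, hη, fun t => φ.symm (x t), fun t ht => ?_⟩
  have hsrc : φ.symm (x t) ∈ φ.source := φ.map_target (hball (hs2 ht))
  refine (hasMFDerivWithinAt_iff_chart p ht (by rwa [← extChartAt_source 𝓘(ℝ, V)])).2 ⟨?_, ?_⟩
  · exact ((continuousOn_extChartAt_symm p).continuousAt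
      ((isOpen_extChartAt_target p).mem_nhds (hball (hs2 ht)))).comp_continuousWithinAt
      ((hx t (hs1 ht)).continuousWithinAt.mono hs1)
  · have h1 : EqOn (fun u => φ (φ.symm (x u))) x (Icc (t₀ - η) (t₀ + η)) :=
      fun u hu => φ.right_inv (hball (hs2 hu))
    have h2 := ((hx t (hs1 ht)).mono hs1).congr h1 (h1 ht)
    have h3 : φ (φ.symm (x t)) = x t := h1 ht
    rw [← h3] at h2
    exact h2

/-- For continuous `ξ` there are curves on `[0, 1]` with body velocity `ξ` and any given starting
point: local solutions exist near every time, and can be moved by left translation so that they fit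
together. -/
theorem exists_curve [CompleteSpace V] {ξ : ℝ → V} (hξ : ContinuousOn ξ (Icc 0 1)) (g₀ : G) :
    ∃ g : ℝ → G, g 0 = g₀ ∧ HasBodyVelocityOn (V := V) g ξ (Icc 0 1) := by
  -- extended by constants to all of `ℝ`, `ξ` has local solutions on both sides of `0` and `1`
  set ξ' : ℝ → V := IccExtend zero_le_one ((Icc (0 : ℝ) 1).domRestrict ξ)
  have hξ' : Continuous ξ' := hξ.domRestrict.Icc_extend'
  have heq : ∀ t ∈ Icc (0 : ℝ) 1, ξ' t = ξ t := fun t ht => IccExtend_of_mem _ _ ht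
  choose ε hε k hk using exists_local_curve G hξ'
  obtain ⟨t, ht0, hmono, ⟨m, hm⟩, hcov⟩ := exists_monotone_Icc_subset_open_cover_Icc
    (zero_le_one (α := ℝ)) (c := fun i : ℝ => {u : Icc (0 : ℝ) 1 | (u : ℝ) ∈ Ioo (i - ε i) (i + ε i)})
    (fun i => isOpen_Ioo.preimage continuous_subtype_val)
    (fun u _ => mem_iUnion.2 ⟨u, by simp [hε u], by simp [hε u]⟩)
  have step : ∀ n, ∃ γ : ℝ → G,
      HasBodyVelocityOn (V := V) γ ξ' (Icc (t n : ℝ) (t (n + 1))) := by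
    intro n
    obtain ⟨i, hi⟩ := hcov n
    refine ⟨k i, (hk i).mono fun u hu => ?_⟩
    have hu01 : u ∈ Icc (0 : ℝ) 1 := ⟨(t n).2.1.trans hu.1, hu.2.trans (t (n + 1)).2.2⟩
    have := hi (show (⟨u, hu01⟩ : Icc (0 : ℝ) 1) ∈ Icc (t n) (t (n + 1)) from ⟨hu.1, hu.2⟩)
    exact ⟨this.1.le, this.2.le⟩
  have main : ∀ n, ∃ g : ℝ → G, g 0 = g₀ ∧
      HasBodyVelocityOn (V := V) g ξ' (Icc (0 : ℝ) (t n)) := by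
    intro n
    induction n with
    | zero =>
      obtain ⟨γ, hγ⟩ := step 0
      refine ⟨fun u => g₀ * (γ 0)⁻¹ * γ u, by simp, (hγ.const_mul _).mono ?_⟩
      rw [ht0]
      exact Icc_subset_Icc_right (t (0 + 1)).2.1
    | succ n ih =>
      obtain ⟨g, hg0, hg⟩ := ih
      obtain ⟨γ, hγ⟩ := step n
      refine ⟨_, ?_, hg.glue (t n).2.1 (hmono n.le_succ) (hγ.const_mul (g (t n) * (γ (t n))⁻¹))
        (by simp)⟩
      simp [(t n).2.1, hg0]
  obtain ⟨g, hg0, hg⟩ := main m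
  rw [hm m le_rfl] at hg
  exact ⟨g, hg0, hg.congr heq⟩

/-- A curve is determined by its starting point and its continuous body velocity. -/
theorem HasBodyVelocityOn.eqOn [T2Space G] {g k : ℝ → G} {ξ : ℝ → V} {a b : ℝ}
    (hξ : ContinuousOn ξ (Icc a b)) (hg : HasBodyVelocityOn (V := V) g ξ (Icc a b))
    (hk : HasBodyVelocityOn (V := V) k ξ (Icc a b)) (h : g a = k a) : EqOn g k (Icc a b) := by
  obtain ⟨C, hC⟩ := isCompact_Icc.exists_bound_of_continuousOn hξ
  have hclosed : IsClosed ({t | g t = k t} ∩ Icc a b) := by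
    have h1 : ContinuousOn (fun t => (g t, k t)) (Icc a b) :=
      hg.continuousOn.prodMk hk.continuousOn
    have h2 := h1.preimage_isClosed_of_isClosed isClosed_Icc (isClosed_diagonal (X := G))
    rwa [inter_comm] at h2
  refine hclosed.Icc_subset_of_forall_exists_gt h ?_
  rintro t₀ ⟨heq, ht₀⟩ y hy
  have heq : g t₀ = k t₀ := heq
  have ht₀' : t₀ ∈ Icc a b := ⟨ht₀.1, ht₀.2.le⟩
  have hC0 : 0 ≤ C := (norm_nonneg _).trans (hC t₀ ht₀')
  set p := g t₀
  set φ := extChartAt 𝓘(ℝ, V) p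
  have hT : φ.target ∈ 𝓝 (φ p) := extChartAt_target_mem_nhds p
  obtain ⟨K, s, hs, hlip⟩ := (((contDiffOn_chartField (V := V) p).contDiffAt hT).of_le
    (show (1 : WithTop ℕ∞) ≤ (∞ : ℕ∞ω) by simp)).exists_lipschitzOnWith
  have hφ : ContinuousAt φ p := continuousAt_extChartAt p
  have hnear : ∀ f : ℝ → G, HasBodyVelocityOn (V := V) f ξ (Icc a b) → f t₀ = p →
      ∀ᶠ t in 𝓝[Icc a b] t₀, f t ∈ φ.source ∧ φ (f t) ∈ s := by
    intro f hf hfp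
    have h1 : Tendsto f (𝓝[Icc a b] t₀) (𝓝 p) := by
      have := hf.continuousOn t₀ ht₀'
      rwa [ContinuousWithinAt, hfp] at this
    filter_upwards [h1 ((isOpen_extChartAt_source (I := 𝓘(ℝ, V)) p).mem_nhds
      (mem_extChartAt_source p)), h1 (hφ.preimage_mem_nhds hs)] with t h2 h3
    exact ⟨h2, h3⟩
  obtain ⟨δ, hδ, hball⟩ := Metric.mem_nhdsWithin_iff.1
    ((hnear g hg rfl).and (hnear k hk heq.symm))
  set c := min (min b y) (t₀ + δ / 2)
  have hc : t₀ < c := lt_min (lt_min ht₀.2 hy) (by linarith)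
  have hcb : c ≤ b := (min_le_left _ _).trans (min_le_left _ _)
  have hcy : c ≤ y := (min_le_left _ _).trans (min_le_right _ _)
  have hsub : Icc t₀ c ⊆ Icc a b := Icc_subset_Icc ht₀.1 hcb
  have hin : ∀ t ∈ Icc t₀ c, (g t ∈ φ.source ∧ φ (g t) ∈ s) ∧ (k t ∈ φ.source ∧ φ (k t) ∈ s) := by
    intro t ht
    refine hball ⟨?_, hsub ht⟩
    rw [Metric.mem_ball, Real.dist_eq, abs_lt]
    have : c ≤ t₀ + δ / 2 := min_le_right _ _
    constructor <;> linarith [ht.1, ht.2]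
  have hder : ∀ f : ℝ → G, HasBodyVelocityOn (V := V) f ξ (Icc a b) →
      (∀ t ∈ Icc t₀ c, f t ∈ φ.source) → ∀ t ∈ Icc t₀ c,
      HasDerivWithinAt (fun u => φ (f u)) (chartField p (φ (f t)) (ξ t)) (Icc t₀ c) t := by
    intro f hf hsrc t ht
    exact ((hasMFDerivWithinAt_iff_chart p (hsub ht) (by
      rw [← extChartAt_source 𝓘(ℝ, V)]; exact hsrc t ht)).1 (hf t (hsub ht))).2.mono hsub
  have hg' := hder g hg fun t ht => (hin t ht).1.1
  have hk' := hder k hk fun t ht => (hin t ht).2.1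
  have hIci : ∀ t ∈ Ico t₀ c, Icc t₀ c ∈ 𝓝[Ici t] t := fun t ht =>
    mem_of_superset (Icc_mem_nhdsGE ht.2) (Icc_subset_Icc_left ht.1)
  have huniq := ODE_solution_unique_of_mem_Icc_right (v := fun t x => chartField p x (ξ t))
    (K := K * C.toNNReal) (s := fun _ => s) (a := t₀) (b := c)
    (f := fun u => φ (g u)) (g := fun u => φ (k u)) (fun t ht => by
      refine LipschitzOnWith.of_dist_le_mul fun x hx y hy => ?_
      rw [dist_eq_norm, ← sub_apply]
      refine (ContinuousLinearMap.le_opNorm _ _).trans ?_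
      have h1 := hlip.dist_le_mul x hx y hy
      rw [dist_eq_norm] at h1
      have h2 := hC t (hsub (Ico_subset_Icc_self ht))
      calc ‖chartField p x - chartField p y‖ * ‖ξ t‖ ≤ (K * dist x y) * C := by gcongr
        _ = _ := by rw [NNReal.coe_mul, Real.coe_toNNReal C hC0]; ring)
    (HasDerivWithinAt.continuousOn hg')
    (fun t ht => (hg' t (Ico_subset_Icc_self ht)).mono_of_mem_nhdsWithin (hIci t ht))
    (fun t ht => (hin t (Ico_subset_Icc_self ht)).1.2)
    (HasDerivWithinAt.continuousOn hk')
    (fun t ht => (hk' t (Ico_subset_Icc_self ht)).mono_of_mem_nhdsWithin (hIci t ht))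
    (fun t ht => (hin t (Ico_subset_Icc_self ht)).2.2)
    (congrArg φ heq)
  have hcm : c ∈ Icc t₀ c := ⟨hc.le, le_rfl⟩
  exact ⟨c, φ.injOn (hin c hcm).1.1 (hin c hcm).2.1 (huniq hcm), hc, hcy⟩

end ExistenceUniqueness

end Reparam

/-! ### The action on space and the quadratic form of the cost -/

namespace Reparam

open Filter Topology

section Action

variable {V : Type*} [NormedAddCommGroup V] [NormedSpace ℝ V]
  {G : Type*} [TopologicalSpace G] [ChartedSpace V G] [Group G]
  {n : ℕ} [MulAction G (EuclideanSpace ℝ (Fin n))]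

/-- Inverting group elements changes the sign of the infinitesimal action: differentiate
`a • (a⁻¹ • y) = y` at the identity. -/
theorem mfderiv_inv_smul [LieGroup 𝓘(ℝ, V) ∞ G]
    [ContMDiffSMul 𝓘(ℝ, V) 𝓘(ℝ, EuclideanSpace ℝ (Fin n)) ∞ G (EuclideanSpace ℝ (Fin n))]
    (v : GroupLieAlgebra 𝓘(ℝ, V) G) (y : EuclideanSpace ℝ (Fin n)) :
    (mfderiv 𝓘(ℝ, V) 𝓘(ℝ, EuclideanSpace ℝ (Fin n)) (fun a : G => a⁻¹ • y) 1 v :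
      EuclideanSpace ℝ (Fin n)) = -infAction v y := by
  set f : G × G → EuclideanSpace ℝ (Fin n) := fun p => p.1 • (p.2⁻¹ • y)
  have hf : ContMDiff (𝓘(ℝ, V).prod 𝓘(ℝ, V)) 𝓘(ℝ, EuclideanSpace ℝ (Fin n)) ∞ f :=
    ContMDiff.smul (I := 𝓘(ℝ, V)) contMDiff_fst
      (ContMDiff.smul (I := 𝓘(ℝ, V)) (contMDiff_snd.inv) contMDiff_const)
  have hfd : MDifferentiableAt (𝓘(ℝ, V).prod 𝓘(ℝ, V)) 𝓘(ℝ, EuclideanSpace ℝ (Fin n)) f (1, 1) :=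
    hf.mdifferentiable (by simp) _
  have h1 := mfderiv_prod_eq_add_apply (v := ((v, v) : V × V)) hfd
  have h2 := (HasMFDerivAt.comp (f := fun a : G => (id a, id a)) (1 : G)
    hfd.hasMFDerivAt ((hasMFDerivAt_id (I := 𝓘(ℝ, V)) (1 : G)).prodMk
    (hasMFDerivAt_id (I := 𝓘(ℝ, V)) (1 : G)))).mfderiv
  have h3 : (f ∘ fun a : G => (id a, id a)) = fun _ => y := by
    ext1 a
    simp [f]
  rw [h3, mfderiv_const] at h2
  have h4 : (mfderiv (𝓘(ℝ, V).prod 𝓘(ℝ, V)) 𝓘(ℝ, EuclideanSpace ℝ (Fin n)) f (1, 1)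
      ((v, v) : V × V) : EuclideanSpace ℝ (Fin n)) = 0 :=
    (congrArg (fun L : V →L[ℝ] EuclideanSpace ℝ (Fin n) => L v) h2).symm
  have h5 : (fun z : G => f (z, ((1 : G), (1 : G)).2)) = fun z => z • y := by
    ext1 z
    simp [f]
  have h6 : (fun z : G => f (((1 : G), (1 : G)).1, z)) = fun z => z⁻¹ • y := by
    ext1 z
    simp [f]
  have gen : ∀ (φ ψ : G → EuclideanSpace ℝ (Fin n)) (u w : EuclideanSpace ℝ (Fin n)),
      φ = (fun z => z • y) → ψ = (fun z => z⁻¹ • y) →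
      u = mfderiv 𝓘(ℝ, V) 𝓘(ℝ, EuclideanSpace ℝ (Fin n)) φ 1 v →
      w = mfderiv 𝓘(ℝ, V) 𝓘(ℝ, EuclideanSpace ℝ (Fin n)) ψ 1 v → 0 = u + w →
      (mfderiv 𝓘(ℝ, V) 𝓘(ℝ, EuclideanSpace ℝ (Fin n)) (fun a : G => a⁻¹ • y) 1 v :
      EuclideanSpace ℝ (Fin n)) = -infAction v y := by
    rintro φ ψ u w rfl rfl rfl rfl h
    exact eq_neg_of_add_eq_zero_right h.symm
  exact gen _ _ _ _ h5 h6 rfl rfl (h4.symm.trans h1)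

/-- The velocity of the moving point `g(t)⁻¹ • x`. -/
theorem HasBodyVelocityOn.hasDerivWithinAt_inv_smul [LieGroup 𝓘(ℝ, V) ∞ G]
    [ContMDiffSMul 𝓘(ℝ, V) 𝓘(ℝ, EuclideanSpace ℝ (Fin n)) ∞ G (EuclideanSpace ℝ (Fin n))]
    {g : ℝ → G} {ξ : ℝ → GroupLieAlgebra 𝓘(ℝ, V) G} {s : Set ℝ} (hg : HasBodyVelocityOn g ξ s)
    (x : EuclideanSpace ℝ (Fin n)) {t : ℝ} (ht : t ∈ s) :
    HasDerivWithinAt (fun u => (g u)⁻¹ • x) (-infAction (ξ t) ((g t)⁻¹ • x)) s t := by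
  have hA : MDifferentiable 𝓘(ℝ, V) 𝓘(ℝ, EuclideanSpace ℝ (Fin n)) (fun a : G => a⁻¹ • x) :=
    (ContMDiff.smul (I := 𝓘(ℝ, V)) (contMDiff_inv 𝓘(ℝ, V) ∞) contMDiff_const).mdifferentiable
      (n := ∞) (by simp)
  have h1 := (hA (g t)).hasMFDerivAt.comp_hasMFDerivWithinAt t (hg t ht)
  have h2 := mfderiv_mulInvariantVectorField (hA (g t)) (ξ t)
  have h3 : (fun b : G => (g t * b)⁻¹ • x) = fun b => b⁻¹ • ((g t)⁻¹ • x) := by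
    ext1 b
    rw [mul_inv_rev, mul_smul]
  have h4 := h2.trans ((congrArg (fun f : G → EuclideanSpace ℝ (Fin n) =>
    (mfderiv 𝓘(ℝ, V) 𝓘(ℝ, EuclideanSpace ℝ (Fin n)) f (1 : G) (ξ t) :
      EuclideanSpace ℝ (Fin n))) h3).trans (mfderiv_inv_smul (ξ t) ((g t)⁻¹ • x)))
  exact HasFDerivWithinAt.congr_fderiv (hasMFDerivWithinAt_iff_hasFDerivWithinAt.1 h1)
    ((comp_smulRight_one (E := V) (F := EuclideanSpace ℝ (Fin n)) _ _).trans
      ((congrArg (fun w : EuclideanSpace ℝ (Fin n) => (1 : ℝ →L[ℝ] ℝ).smulRight w) h4).trans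
        (smulRight_one_eq_toSpanSingleton _)))

/-- The rate of change of `h` along a moving point splits into the space and time derivatives. -/
theorem derivWithin_comp_curve {h : EuclideanSpace ℝ (Fin n) → ℝ → ℝ}
    (hdiff : DifferentiableOn ℝ (Function.uncurry h) (univ ×ˢ Icc (0 : ℝ) 1))
    {y : ℝ → EuclideanSpace ℝ (Fin n)} {y' : EuclideanSpace ℝ (Fin n)} {τ : ℝ → ℝ} {τ' t : ℝ}
    (ht : t ∈ Icc (0 : ℝ) 1) (hy : HasDerivWithinAt y y' (Icc 0 1) t)
    (hτ : HasDerivWithinAt τ τ' (Icc 0 1) t) (hτm : MapsTo τ (Icc 0 1) (Icc 0 1)) :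
    derivWithin (fun u => h (y u) (τ u)) (Icc (0 : ℝ) 1) t =
      fderiv ℝ (fun z => h z (τ t)) (y t) y' + τ' * timeDeriv h (y t) (τ t) := by
  have hu := uniqueDiffOn_Icc (zero_lt_one (α := ℝ))
  set D := fderivWithin ℝ (Function.uncurry h) (univ ×ˢ Icc (0 : ℝ) 1) (y t, τ t)
  have hD : HasFDerivWithinAt (Function.uncurry h) D (univ ×ˢ Icc (0 : ℝ) 1) (y t, τ t) :=
    (hdiff (y t, τ t) ⟨mem_univ _, hτm ht⟩).hasFDerivWithinAt
  have h1 : HasDerivWithinAt (fun u => h (y u) (τ u)) (D (y', τ')) (Icc (0 : ℝ) 1) t :=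
    hD.comp_hasDerivWithinAt (f := fun u => (y u, τ u)) t (hy.prodMk hτ)
      (fun u hu' => ⟨mem_univ _, hτm hu'⟩)
  have h2 : HasFDerivAt (fun z => h z (τ t)) (D.comp (ContinuousLinearMap.inl ℝ _ ℝ)) (y t) := by
    have := HasFDerivWithinAt.comp (f := fun z : EuclideanSpace ℝ (Fin n) => (z, τ t))
      (s := univ) (y t) hD (hasFDerivAt_prodMk_left (y t) (τ t)).hasFDerivWithinAt
      (fun u _ => ⟨mem_univ _, hτm ht⟩)
    exact hasFDerivWithinAt_univ.1 this
  have h3 : HasDerivWithinAt (fun u => h (y t) u) (D (0, 1)) (Icc (0 : ℝ) 1) (τ t) :=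
    hD.comp_hasDerivWithinAt (f := fun u => (y t, u)) (τ t)
      ((hasDerivWithinAt_const _ _ _).prodMk (hasDerivWithinAt_id _ _))
      (fun u hu' => ⟨mem_univ _, hu'⟩)
  rw [h1.derivWithin (hu t ht), h2.fderiv, timeDeriv, h3.derivWithin (hu _ (hτm ht))]
  have h4 : ((y', τ') : EuclideanSpace ℝ (Fin n) × ℝ) = (y', 0) + τ' • (0, 1) := by simp
  rw [h4, map_add, map_smul]
  rfl

theorem spaceDeriv_sum {N : ℕ} (h : EuclideanSpace ℝ (Fin n) → ℝ → ℝ)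
    (E : Fin N → GroupLieAlgebra 𝓘(ℝ, V) G) (c : Fin N → ℝ) (y : EuclideanSpace ℝ (Fin n)) (s : ℝ) :
    spaceDeriv h (∑ i, c i • E i) y s = ∑ i, c i * spaceDeriv h (E i) y s := by
  have h1 : infAction (∑ i, c i • E i) y = ∑ i, c i • infAction (E i) y := by
    have gen : ∀ L : V →L[ℝ] EuclideanSpace ℝ (Fin n), ∀ F : Fin N → V,
        L (∑ i, c i • F i) = ∑ i, c i • L (F i) := by
      intro L F
      simp
    exact gen _ _
  simp [spaceDeriv, h1]

/-- A transformation of `ℝⁿ` with unit Jacobian preserves Lebesgue integrals. -/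
theorem lintegral_inv_smul [LieGroup 𝓘(ℝ, V) ∞ G]
    [ContMDiffSMul 𝓘(ℝ, V) 𝓘(ℝ, EuclideanSpace ℝ (Fin n)) ∞ G (EuclideanSpace ℝ (Fin n))]
    (hΔ : ∀ (g : G) (y : EuclideanSpace ℝ (Fin n)), jacobian g y = 1) (g : G)
    (F : EuclideanSpace ℝ (Fin n) → ℝ≥0∞) : ∫⁻ x, F (g⁻¹ • x) = ∫⁻ y, F y := by
  have hd : Differentiable ℝ (fun z : EuclideanSpace ℝ (Fin n) => g • z) :=
    ((contMDiff_const.smul (I := 𝓘(ℝ, V)) contMDiff_id).contDiff (n := ∞)).differentiable (by simp)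
  have h1 := lintegral_image_eq_lintegral_abs_det_fderiv_mul volume MeasurableSet.univ
    (fun x _ => (hd x).hasFDerivAt.hasFDerivWithinAt) (MulAction.injective g).injOn
    (fun x => F (g⁻¹ • x))
  rw [image_univ, (MulAction.surjective g).range_eq] at h1
  have h2 : ∀ x, |(fderiv ℝ (fun z : EuclideanSpace ℝ (Fin n) => g • z) x).det| = 1 := hΔ g
  simpa [h2] using h1

end Action

section QuadraticForm

variable {α : Type*} [MeasurableSpace α] {μ : Measure α} {N : ℕ} {S : Fin N → α → ℝ} {T : α → ℝ}

/-- The squared `L²` norm of `∑ cᵢ Sᵢ`, through the Gram matrix of the `Sᵢ`. -/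
theorem integral_sum_sq (hS : ∀ i, MemLp (S i) 2 μ) (c : Fin N → ℝ) :
    ∫ y, (∑ i, c i * S i y) ^ 2 ∂μ =
      c ⬝ᵥ ((Matrix.of fun i j => ∫ y, S i y * S j y ∂μ) *ᵥ c) := by
  have hint : ∀ i j, Integrable (fun y => S i y * S j y) μ :=
    fun i j => (hS i).integrable_mul (hS j)
  have h1 : ∀ y, (∑ i, c i * S i y) ^ 2 = ∑ i, ∑ j, c i * c j * (S i y * S j y) := by
    intro y
    rw [sq, Finset.sum_mul_sum]
    exact Finset.sum_congr rfl fun i _ => Finset.sum_congr rfl fun j _ => by ring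
  simp_rw [h1]
  rw [integral_finsetSum _ fun i _ => integrable_finsetSum _ fun j _ => (hint i j).const_mul _]
  simp only [dotProduct, Matrix.mulVec, Matrix.of_apply, Finset.mul_sum]
  refine Finset.sum_congr rfl fun i _ => ?_
  rw [integral_finsetSum _ fun j _ => (hint i j).const_mul _]
  refine Finset.sum_congr rfl fun j _ => ?_
  rw [integral_const_mul]
  ring

theorem posSemidef_gram (hS : ∀ i, MemLp (S i) 2 μ) :
    (Matrix.of fun i j => ∫ y, S i y * S j y ∂μ).PosSemidef := by
  refine Matrix.PosSemidef.of_dotProduct_mulVec_nonneg ?_ fun c => ?_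
  · ext i j
    simp [mul_comm]
  · rw [star_trivial, ← integral_sum_sq hS]
    exact integral_nonneg fun y => sq_nonneg _

theorem lintegral_ofReal_sq_sub (hS : ∀ i, MemLp (S i) 2 μ) (hT : MemLp T 2 μ) (c : Fin N → ℝ)
    (a : ℝ) :
    ∫⁻ y, ENNReal.ofReal (|-(∑ i, c i * S i y) + a * T y| ^ 2) ∂μ =
      ENNReal.ofReal (c ⬝ᵥ ((Matrix.of fun i j => ∫ y, S i y * S j y ∂μ) *ᵥ c)
        - 2 * a * (c ⬝ᵥ fun i => ∫ y, S i y * T y ∂μ) + a ^ 2 * ∫ y, T y ^ 2 ∂μ) := by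
  have hsum : MemLp (fun y => ∑ i, c i * S i y) 2 μ :=
    memLp_finsetSum _ fun i _ => (hS i).const_mul (c i)
  have hST : ∀ i, Integrable (fun y => S i y * T y) μ := fun i => (hS i).integrable_mul hT
  have hint : Integrable (fun y => (-(∑ i, c i * S i y) + a * T y) ^ 2) μ :=
    (hsum.neg.add (hT.const_mul a)).integrable_sq
  simp_rw [sq_abs]
  rw [← ofReal_integral_eq_lintegral_ofReal hint (ae_of_all _ fun y => sq_nonneg _)]
  congr 1
  have h1 : ∀ y, (-(∑ i, c i * S i y) + a * T y) ^ 2 = (∑ i, c i * S i y) ^ 2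
      - 2 * a * (∑ i, c i * (S i y * T y)) + a ^ 2 * T y ^ 2 := by
    intro y
    have : ∑ i, c i * (S i y * T y) = (∑ i, c i * S i y) * T y := by
      rw [Finset.sum_mul]
      exact Finset.sum_congr rfl fun i _ => by ring
    rw [this]
    ring
  have hI : Integrable (fun y => ∑ i, c i * (S i y * T y)) μ :=
    integrable_finsetSum _ fun i _ => (hST i).const_mul _
  have hA : Integrable (fun y => (∑ i, c i * S i y) ^ 2 - 2 * a * ∑ i, c i * (S i y * T y)) μ :=
    hsum.integrable_sq.sub (hI.const_mul _)
  simp_rw [h1]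
  rw [integral_add hA (hT.integrable_sq.const_mul _),
    integral_sub hsum.integrable_sq (hI.const_mul _), integral_const_mul, integral_const_mul,
    integral_sum_sq hS, integral_finsetSum _ fun i _ => (hST i).const_mul _]
  simp only [integral_const_mul, dotProduct]

/-- Completing the square in `c` for a symmetric invertible matrix. -/
theorem quadratic_complete_square {M : Matrix (Fin N) (Fin N) ℝ} (hM : M.IsSymm)
    (hdet : IsUnit M.det) (b c : Fin N → ℝ) (a γ : ℝ) :
    c ⬝ᵥ (M *ᵥ c) - 2 * a * (c ⬝ᵥ b) + a ^ 2 * γ =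
      (c - a • (M⁻¹ *ᵥ b)) ⬝ᵥ (M *ᵥ (c - a • (M⁻¹ *ᵥ b))) +
        a ^ 2 * (γ - b ⬝ᵥ (M⁻¹ *ᵥ b)) := by
  set z := M⁻¹ *ᵥ b
  have hz : M *ᵥ z = b := by
    rw [Matrix.mulVec_mulVec, Matrix.mul_nonsing_inv _ hdet, Matrix.one_mulVec]
  have h1 : z ⬝ᵥ (M *ᵥ c) = c ⬝ᵥ b := by
    rw [Matrix.dotProduct_mulVec, ← Matrix.mulVec_transpose, hM.eq, hz, dotProduct_comm]
  rw [Matrix.mulVec_sub, Matrix.mulVec_smul, hz, sub_dotProduct, dotProduct_sub, dotProduct_sub,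
    smul_dotProduct, smul_dotProduct, dotProduct_smul, dotProduct_smul, h1, dotProduct_comm z b]
  simp only [smul_eq_mul]
  ring

end QuadraticForm

end Reparam

/-! ### Optimal reparameterizations -/

namespace Reparam

open Filter Topology

section Reparameterization

variable {r : ℕ∞} {𝔤 : ℝ → ℝ} {τ : ℝ → ℝ}

theorem TRG.contDiffOn_one (hr : 1 ≤ r) (hτ : τ ∈ TRG r) : ContDiffOn ℝ 1 τ (Icc 0 1) :=
  hτ.1.of_le (by exact_mod_cast hr)

theorem TRG.mapsTo (hτ : τ ∈ TRG r) : MapsTo τ (Icc 0 1) (Icc 0 1) := hτ.2.2.2.2.1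

theorem TRG.hasDerivWithinAt (hr : 1 ≤ r) (hτ : τ ∈ TRG r) {t : ℝ} (ht : t ∈ Icc (0 : ℝ) 1) :
    HasDerivWithinAt τ (derivWithin τ (Icc 0 1) t) (Icc 0 1) t :=
  ((TRG.contDiffOn_one hr hτ).differentiableOn (by simp) t ht).hasDerivWithinAt

theorem TRG.continuousOn_derivWithin (hr : 1 ≤ r) (hτ : τ ∈ TRG r) :
    ContinuousOn (derivWithin τ (Icc (0 : ℝ) 1)) (Icc 0 1) :=
  (TRG.contDiffOn_one hr hτ).continuousOn_derivWithin (uniqueDiffOn_Icc zero_lt_one) (by simp)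

theorem TRG.derivWithin_nonneg (hτ : τ ∈ TRG r) (t : ℝ) : 0 ≤ derivWithin τ (Icc (0 : ℝ) 1) t :=
  hτ.2.1.monotoneOn.derivWithin_nonneg

theorem id_mem_TRG (r : ℕ∞) : (fun t : ℝ => t) ∈ TRG r :=
  ⟨contDiffOn_id, strictMonoOn_id, rfl, rfl, mapsTo_id _, id, contDiffOn_id, mapsTo_id _,
    fun _ _ => rfl, fun _ _ => rfl⟩

/-- The speed `√𝔤(τ) τ'` of a reparameterization in the metric `𝔤 dx²` on `[0, 1]`. -/
def metricSpeed (𝔤 τ : ℝ → ℝ) (t : ℝ) : ℝ :=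
  √(𝔤 (τ t)) * derivWithin τ (Icc (0 : ℝ) 1) t

/-- The length `∫₀¹ √𝔤` of `[0, 1]` in the metric `𝔤 dx²`. -/
def metricLength (𝔤 : ℝ → ℝ) : ℝ := ∫ x in (0 : ℝ)..1, √(𝔤 x)

theorem continuousOn_metricSpeed (hr : 1 ≤ r) (h𝔤 : ContinuousOn 𝔤 (Icc 0 1)) (hτ : τ ∈ TRG r) :
    ContinuousOn (metricSpeed 𝔤 τ) (Icc 0 1) :=
  ((h𝔤.comp hτ.1.continuousOn (TRG.mapsTo hτ)).sqrt).mul (TRG.continuousOn_derivWithin hr hτ)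

/-- The arc length function of the metric `𝔤 dx²`, extended to a bijection of `ℝ`. -/
theorem exists_arcLength (h𝔤 : ContinuousOn 𝔤 (Icc 0 1)) (hpos : ∀ x ∈ Icc (0 : ℝ) 1, 0 < 𝔤 x) :
    ∃ (Φ : ℝ ≃o ℝ) (W : ℝ → ℝ), Φ 0 = 0 ∧ Φ 1 = metricLength 𝔤 ∧ (∀ x, 0 < W x) ∧
      (∀ x ∈ Icc (0 : ℝ) 1, W x = √(𝔤 x)) ∧ ∀ x, HasDerivAt Φ (W x) x := by
  set W : ℝ → ℝ := IccExtend zero_le_one ((Icc (0 : ℝ) 1).domRestrict fun x => √(𝔤 x)) with hW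
  have hWc : Continuous W := h𝔤.sqrt.domRestrict.Icc_extend'
  have hWeq : ∀ x ∈ Icc (0 : ℝ) 1, W x = √(𝔤 x) := fun x hx => IccExtend_of_mem _ _ hx
  obtain ⟨x₀, hx₀, hmin⟩ := isCompact_Icc.exists_isMinOn (nonempty_Icc.2 (zero_le_one (α := ℝ)))
    hWc.continuousOn
  have hm : 0 < W x₀ := by
    rw [hWeq x₀ hx₀]
    exact Real.sqrt_pos.2 (hpos x₀ hx₀)
  have hWm : ∀ x, W x₀ ≤ W x := by
    intro x
    have h1 := hmin (projIcc (0 : ℝ) 1 zero_le_one x).2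
    have h2 : W (projIcc (0 : ℝ) 1 zero_le_one x) = W x := by
      simp [hW, IccExtend]
    rwa [mem_ofPred_eq, h2] at h1
  have hWpos : ∀ x, 0 < W x := fun x => hm.trans_le (hWm x)
  set F : ℝ → ℝ := fun x => ∫ y in (0 : ℝ)..x, W y
  have hF : ∀ x, HasDerivAt F (W x) x := fun x => hWc.integral_hasStrictDerivAt 0 x |>.hasDerivAt
  have hF0 : F 0 = 0 := intervalIntegral.integral_same
  have hmono : StrictMono F := strictMono_of_hasDerivAt_pos hF hWpos
  have hcont : Continuous F := continuous_iff_continuousAt.2 fun x => (hF x).continuousAt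
  have hlow : Monotone fun x => F x - W x₀ * x := by
    refine monotone_of_hasDerivAt_nonneg (f' := fun x => W x - W x₀) (fun x => ?_)
      fun x => sub_nonneg.2 (hWm x)
    have h1 := (hF x).sub ((hasDerivAt_id x).const_mul (W x₀))
    rw [mul_one] at h1
    exact h1
  have hsurj : Function.Surjective F := by
    refine hcont.surjective ?_ ?_
    · refine tendsto_atTop_mono' _ ?_ (tendsto_id.const_mul_atTop hm)
      filter_upwards [eventually_ge_atTop 0] with x hx
      have := hlow hx
      simp only [hF0, mul_zero, sub_zero] at this
      simp only [id]
      linarith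
    · refine tendsto_atBot_mono' _ ?_ (tendsto_id.const_mul_atBot hm)
      filter_upwards [eventually_le_atBot 0] with x hx
      have := hlow hx
      simp only [hF0, mul_zero, sub_zero] at this
      simp only [id]
      linarith
  refine ⟨hmono.orderIsoOfSurjective F hsurj, W, hF0, ?_, hWpos, hWeq, hF⟩
  refine intervalIntegral.integral_congr fun x hx => ?_
  rw [uIcc_of_le zero_le_one] at hx
  exact hWeq x hx

theorem metricLength_pos (h𝔤 : ContinuousOn 𝔤 (Icc 0 1)) (hpos : ∀ x ∈ Icc (0 : ℝ) 1, 0 < 𝔤 x) :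
    0 < metricLength 𝔤 := by
  obtain ⟨Φ, W, h0, h1, -, -, -⟩ := exists_arcLength h𝔤 hpos
  rw [← h1, ← h0]
  exact Φ.strictMono zero_lt_one

/-- Every reparameterization traverses the whole of `[0, 1]`. -/
theorem integral_metricSpeed (hr : 1 ≤ r) (h𝔤 : ContinuousOn 𝔤 (Icc 0 1))
    (hpos : ∀ x ∈ Icc (0 : ℝ) 1, 0 < 𝔤 x) (hτ : τ ∈ TRG r) :
    ∫ t in (0 : ℝ)..1, metricSpeed 𝔤 τ t = metricLength 𝔤 := by
  obtain ⟨Φ, W, h0, h1, -, hW, hΦ⟩ := exists_arcLength h𝔤 hpos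
  rw [intervalIntegral.integral_eq_sub_of_hasDerivAt_of_le (f := fun t => Φ (τ t)) zero_le_one]
  · rw [hτ.2.2.2.1, hτ.2.2.1, h0, h1, sub_zero]
  · exact Φ.continuous.comp_continuousOn hτ.1.continuousOn
  · intro t ht
    have ht' := Ioo_subset_Icc_self ht
    have h2 := (hΦ (τ t)).comp t ((TRG.hasDerivWithinAt hr hτ ht').hasDerivAt
      (Icc_mem_nhds ht.1 ht.2))
    rw [hW _ (TRG.mapsTo hτ ht')] at h2
    exact h2
  · exact (continuousOn_metricSpeed hr h𝔤 hτ).intervalIntegrable_of_Icc zero_le_one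

theorem reparamIntegrand_eq_metricSpeed_sq (hpos : ∀ x ∈ Icc (0 : ℝ) 1, 0 < 𝔤 x) (hτ : τ ∈ TRG r)
    {t : ℝ} (ht : t ∈ Icc (0 : ℝ) 1) :
    reparamIntegrand 𝔤 (τ t) (derivWithin τ (Icc (0 : ℝ) 1) t) = metricSpeed 𝔤 τ t ^ 2 := by
  rw [reparamIntegrand, metricSpeed, mul_pow, Real.sq_sqrt (hpos _ (TRG.mapsTo hτ ht)).le, mul_comm]

/-- The energy exceeds the squared length by the variance of the speed. -/
theorem functional_eq_add (hr : 1 ≤ r) (h𝔤 : ContinuousOn 𝔤 (Icc 0 1))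
    (hpos : ∀ x ∈ Icc (0 : ℝ) 1, 0 < 𝔤 x) (hτ : τ ∈ TRG r) :
    functional (reparamIntegrand 𝔤) τ = metricLength 𝔤 ^ 2 +
      ∫ t in (0 : ℝ)..1, (metricSpeed 𝔤 τ t - metricLength 𝔤) ^ 2 := by
  have hc := continuousOn_metricSpeed hr h𝔤 hτ
  have hi : ∀ f : ℝ → ℝ, ContinuousOn f (Icc 0 1) → IntervalIntegrable f volume 0 1 :=
    fun f hf => hf.intervalIntegrable_of_Icc zero_le_one
  set L := metricLength 𝔤 with hL
  have h1 : functional (reparamIntegrand 𝔤) τ = ∫ t in (0 : ℝ)..1, metricSpeed 𝔤 τ t ^ 2 := by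
    refine intervalIntegral.integral_congr fun t ht => ?_
    rw [uIcc_of_le zero_le_one] at ht
    exact reparamIntegrand_eq_metricSpeed_sq hpos hτ ht
  have h2 : ∀ t, (metricSpeed 𝔤 τ t - L) ^ 2 =
      metricSpeed 𝔤 τ t ^ 2 - 2 * L * metricSpeed 𝔤 τ t + L ^ 2 := fun t => by ring
  simp_rw [h2]
  rw [h1, intervalIntegral.integral_add (hi _ (by fun_prop)) (hi _ continuousOn_const),
    intervalIntegral.integral_sub (hi _ (by fun_prop)) (hi _ (by fun_prop)),
    intervalIntegral.integral_const_mul, integral_metricSpeed hr h𝔤 hpos hτ,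
    intervalIntegral.integral_const]
  simp only [smul_eq_mul, sub_zero, one_mul, ← hL]
  ring

theorem sq_metricLength_le_functional (hr : 1 ≤ r) (h𝔤 : ContinuousOn 𝔤 (Icc 0 1))
    (hpos : ∀ x ∈ Icc (0 : ℝ) 1, 0 < 𝔤 x) (hτ : τ ∈ TRG r) :
    metricLength 𝔤 ^ 2 ≤ functional (reparamIntegrand 𝔤) τ := by
  rw [functional_eq_add hr h𝔤 hpos hτ]
  have := intervalIntegral.integral_nonneg (μ := volume) (zero_le_one (α := ℝ))
    fun t _ => sq_nonneg (metricSpeed 𝔤 τ t - metricLength 𝔤)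
  linarith

theorem functional_eq_sq_iff (hr : 1 ≤ r) (h𝔤 : ContinuousOn 𝔤 (Icc 0 1))
    (hpos : ∀ x ∈ Icc (0 : ℝ) 1, 0 < 𝔤 x) (hτ : τ ∈ TRG r) :
    functional (reparamIntegrand 𝔤) τ = metricLength 𝔤 ^ 2 ↔
      ∀ t ∈ Icc (0 : ℝ) 1, metricSpeed 𝔤 τ t = metricLength 𝔤 := by
  rw [functional_eq_add hr h𝔤 hpos hτ, add_eq_left]
  have hc : ContinuousOn (fun t => (metricSpeed 𝔤 τ t - metricLength 𝔤) ^ 2) (Icc 0 1) :=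
    ((continuousOn_metricSpeed hr h𝔤 hτ).sub continuousOn_const).pow 2
  constructor
  · intro h t ht
    by_contra hne
    have := intervalIntegral.integral_pos zero_lt_one hc (fun s _ => sq_nonneg _)
      ⟨t, ht, by have := sub_ne_zero.2 hne; positivity⟩
    exact this.ne' h
  · intro h
    rw [intervalIntegral.integral_congr (g := fun _ => (0 : ℝ)), intervalIntegral.integral_zero]
    intro t ht
    rw [uIcc_of_le zero_le_one] at ht
    simp [h t ht]

/-- There is a reparameterization with constant speed, and only one. -/
theorem exists_constant_speed (hr : 1 ≤ r) (h𝔤 : ContDiffOn ℝ r 𝔤 (Icc 0 1))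
    (hpos : ∀ x ∈ Icc (0 : ℝ) 1, 0 < 𝔤 x) :
    ∃ τ₂ ∈ TRG r, ∀ τ ∈ TRG r,
      (∀ t ∈ Icc (0 : ℝ) 1, metricSpeed 𝔤 τ t = metricLength 𝔤) ↔ EqOn τ τ₂ (Icc 0 1) := by
  have hu := uniqueDiffOn_Icc (zero_lt_one (α := ℝ))
  obtain ⟨Φ, W, h0, h1, hWpos, hW, hΦ⟩ := exists_arcLength h𝔤.continuousOn hpos
  have hL := metricLength_pos h𝔤.continuousOn hpos
  set L := metricLength 𝔤
  have hw : ContDiffOn ℝ r (fun x => √(𝔤 x)) (Icc 0 1) := h𝔤.sqrt fun x hx => (hpos x hx).ne'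
  have hw0 : ∀ x ∈ Icc (0 : ℝ) 1, √(𝔤 x) ≠ 0 := fun x hx => (Real.sqrt_pos.2 (hpos x hx)).ne'
  set τ₂ : ℝ → ℝ := fun t => Φ.symm (L * t)
  set σ₂ : ℝ → ℝ := fun x => L⁻¹ * Φ x
  have hτ0 : τ₂ 0 = 0 := by
    change Φ.symm (L * 0) = 0
    rw [mul_zero]
    exact Φ.symm_apply_eq.2 h0.symm
  have hτ1 : τ₂ 1 = 1 := by
    change Φ.symm (L * 1) = 1
    rw [mul_one, ← h1, Φ.symm_apply_apply]
  have hσ0 : σ₂ 0 = 0 := by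
    change L⁻¹ * Φ 0 = 0
    rw [h0, mul_zero]
  have hσ1 : σ₂ 1 = 1 := by simp [σ₂, h1, hL.ne']
  have hτmono : StrictMono τ₂ := fun a b hab => Φ.symm.strictMono (mul_lt_mul_of_pos_left hab hL)
  have hσmono : StrictMono σ₂ :=
    fun a b hab => mul_lt_mul_of_pos_left (Φ.strictMono hab) (inv_pos.2 hL)
  have hτm : MapsTo τ₂ (Icc 0 1) (Icc 0 1) := fun t ht =>
    ⟨hτ0 ▸ hτmono.monotone ht.1, hτ1 ▸ hτmono.monotone ht.2⟩
  have hσm : MapsTo σ₂ (Icc 0 1) (Icc 0 1) := fun t ht =>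
    ⟨hσ0 ▸ hσmono.monotone ht.1, hσ1 ▸ hσmono.monotone ht.2⟩
  have hστ : ∀ t, σ₂ (τ₂ t) = t := fun t => by simp [σ₂, τ₂, hL.ne']
  have hτσ : ∀ t, τ₂ (σ₂ t) = t := fun t => by simp [σ₂, τ₂, hL.ne']
  have hσd : ∀ x, HasDerivAt σ₂ (L⁻¹ * W x) x := fun x => (hΦ x).const_mul L⁻¹
  have hτd : ∀ t, HasDerivAt τ₂ (L⁻¹ * W (τ₂ t))⁻¹ t := by
    intro t
    refine HasDerivAt.of_local_left_inverse ?_ (hσd (τ₂ t)) ?_ (Eventually.of_forall hστ)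
    · exact (Φ.symm.continuous.comp (continuous_const.mul continuous_id)).continuousAt
    · exact (mul_pos (inv_pos.2 hL) (hWpos _)).ne'
  have hσs : ContDiffOn ℝ r σ₂ (Icc 0 1) := by
    refine ODE.contDiffOn_enat_Icc_of_hasDerivWithinAt
      (f := fun t _ => L⁻¹ * √(𝔤 t)) (u := univ) ?_ (fun t ht => ?_) (mapsTo_univ _ _)
    · exact contDiffOn_const.mul (hw.comp contDiffOn_fst fun z hz => hz.1)
    · have := hσd t
      rw [hW t ht] at this
      exact this.hasDerivWithinAt
  have hτs : ContDiffOn ℝ r τ₂ (Icc 0 1) := by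
    refine ODE.contDiffOn_enat_Icc_of_hasDerivWithinAt
      (f := fun _ x => (L⁻¹ * √(𝔤 x))⁻¹) (u := Icc 0 1) ?_ (fun t ht => ?_) hτm
    · exact (contDiffOn_const.mul (hw.comp contDiffOn_snd fun z hz => hz.2)).inv
        fun z hz => mul_ne_zero (inv_ne_zero hL.ne') (hw0 _ hz.2)
    · have := hτd t
      rw [hW _ (hτm ht)] at this
      exact this.hasDerivWithinAt
  refine ⟨τ₂, ⟨hτs, hτmono.strictMonoOn _, hτ0, hτ1, hτm, σ₂, hσs, hσm,
    fun t _ => hστ t, fun t _ => hτσ t⟩, fun τ hτ => ⟨fun h => ?_, fun h t ht => ?_⟩⟩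
  · have hder : ∀ t ∈ Icc (0 : ℝ) 1,
        HasDerivWithinAt (fun u => Φ (τ u) - L * u) 0 (Icc 0 1) t := by
      intro t ht
      have h2 := (hΦ (τ t)).comp_hasDerivWithinAt t (TRG.hasDerivWithinAt hr hτ ht)
      have h3 : W (τ t) * derivWithin τ (Icc (0 : ℝ) 1) t = L := by
        rw [hW _ (TRG.mapsTo hτ ht)]
        exact h t ht
      rw [h3] at h2
      have h4 := h2.sub ((hasDerivWithinAt_id t _).const_mul L)
      rw [mul_one, sub_self] at h4
      exact h4
    intro t ht
    have h4 := constant_of_derivWithin_zero (fun t ht => (hder t ht).differentiableWithinAt)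
      (fun t ht => (hder t (Ico_subset_Icc_self ht)).derivWithin
        (hu t (Ico_subset_Icc_self ht))) t ht
    have h5 : Φ (τ t) = L * t := by
      simp only [hτ.2.2.1, h0, mul_zero, sub_zero] at h4
      linarith
    change τ t = Φ.symm (L * t)
    rw [← h5, Φ.symm_apply_apply]
  · have h2 : derivWithin τ (Icc (0 : ℝ) 1) t = (L⁻¹ * W (τ₂ t))⁻¹ := by
      rw [derivWithin_congr h (h ht)]
      exact (hτd t).hasDerivWithinAt.derivWithin (hu t ht)
    rw [metricSpeed, h2, h ht, hW _ (hτm ht)]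
    have := hw0 _ (hτm ht)
    field_simp

/-- The Euler-Lagrange equation says that the momentum `2 𝔤(τ) τ'` has derivative
`𝔤'(τ) τ'²`. -/
theorem eulerLagrange_iff (h𝔤 : DifferentiableOn ℝ 𝔤 (Icc 0 1))
    (hτ : τ ∈ TRG r) :
    EulerLagrange (reparamIntegrand 𝔤) τ ↔ ∀ t ∈ Icc (0 : ℝ) 1,
      HasDerivWithinAt (fun u => 2 * derivWithin τ (Icc (0 : ℝ) 1) u * 𝔤 (τ u))
        (derivWithin τ (Icc (0 : ℝ) 1) t ^ 2 * derivWithin 𝔤 (Icc 0 1) (τ t)) (Icc 0 1) t := by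
  have h1 : ∀ u, deriv (fun v => reparamIntegrand 𝔤 (τ u) v) (derivWithin τ (Icc (0 : ℝ) 1) u) =
      2 * derivWithin τ (Icc (0 : ℝ) 1) u * 𝔤 (τ u) := by
    intro u
    simp [reparamIntegrand]
  refine forall₂_congr fun t ht => ?_
  simp_rw [h1]
  have h2 : derivWithin (fun y => reparamIntegrand 𝔤 y (derivWithin τ (Icc (0 : ℝ) 1) t))
      (Icc (0 : ℝ) 1) (τ t) =
      derivWithin τ (Icc (0 : ℝ) 1) t ^ 2 * derivWithin 𝔤 (Icc 0 1) (τ t) :=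
    (((h𝔤 _ (TRG.mapsTo hτ ht)).hasDerivWithinAt).const_mul _).derivWithin
      (uniqueDiffOn_Icc zero_lt_one _ (TRG.mapsTo hτ ht))
  rw [h2]

/-- The Euler-Lagrange equation holds exactly when the speed is constant: the energy density is a
first integral. -/
theorem eulerLagrange_iff_metricSpeed (hr : 1 ≤ r) (h𝔤 : ContDiffOn ℝ r 𝔤 (Icc 0 1))
    (hpos : ∀ x ∈ Icc (0 : ℝ) 1, 0 < 𝔤 x) (hτ : τ ∈ TRG r) :
    EulerLagrange (reparamIntegrand 𝔤) τ ↔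
      ∀ t ∈ Icc (0 : ℝ) 1, metricSpeed 𝔤 τ t = metricLength 𝔤 := by
  have hu := uniqueDiffOn_Icc (zero_lt_one (α := ℝ))
  have hd : DifferentiableOn ℝ 𝔤 (Icc 0 1) :=
    h𝔤.differentiableOn (by exact_mod_cast (one_pos.trans_le hr).ne')
  rw [eulerLagrange_iff hd hτ]
  have h𝔤τ : ∀ t ∈ Icc (0 : ℝ) 1, 0 < 𝔤 (τ t) := fun t ht => hpos _ (TRG.mapsTo hτ ht)
  have hcomp : ∀ t ∈ Icc (0 : ℝ) 1, HasDerivWithinAt (fun u => 𝔤 (τ u))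
      (derivWithin 𝔤 (Icc 0 1) (τ t) * derivWithin τ (Icc 0 1) t) (Icc 0 1) t := fun t ht =>
    (hd _ (TRG.mapsTo hτ ht)).hasDerivWithinAt.comp t (TRG.hasDerivWithinAt hr hτ ht)
      (TRG.mapsTo hτ)
  constructor
  · intro hEL
    -- in terms of the momentum `p`, the squared speed is the differentiable function `p² / 4𝔤(τ)`
    have hder : ∀ t ∈ Icc (0 : ℝ) 1,
        HasDerivWithinAt (fun u => metricSpeed 𝔤 τ u ^ 2) 0 (Icc 0 1) t := by
      intro t ht
      have hg := (h𝔤τ t ht).ne'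
      have h1 := ((hEL t ht).pow 2).div ((hcomp t ht).const_mul 4) (by positivity)
      refine (h1.congr_deriv ?_).congr_of_mem (fun u hu' => ?_) ht
      · simp only [Nat.cast_ofNat, Pi.pow_apply]
        field_simp
        ring
      · rw [← reparamIntegrand_eq_metricSpeed_sq hpos hτ hu', reparamIntegrand]
        have := (h𝔤τ u hu').ne'
        simp only [Pi.div_apply, Pi.pow_apply]
        field_simp
        ring
    have hnn : ∀ t, 0 ≤ metricSpeed 𝔤 τ t := fun t =>
      mul_nonneg (Real.sqrt_nonneg _) (TRG.derivWithin_nonneg hτ t)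
    have hconst : ∀ t ∈ Icc (0 : ℝ) 1, metricSpeed 𝔤 τ t = metricSpeed 𝔤 τ 0 := by
      intro t ht
      have := constant_of_derivWithin_zero (fun t ht => (hder t ht).differentiableWithinAt)
        (fun t ht => (hder t (Ico_subset_Icc_self ht)).derivWithin
          (hu t (Ico_subset_Icc_self ht))) t ht
      exact (sq_eq_sq₀ (hnn t) (hnn 0)).1 this
    have hint := integral_metricSpeed hr h𝔤.continuousOn hpos hτ
    rw [intervalIntegral.integral_congr (g := fun _ => metricSpeed 𝔤 τ 0) (fun t ht => by
      rw [uIcc_of_le zero_le_one] at ht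
      exact hconst t ht), intervalIntegral.integral_const] at hint
    intro t ht
    rw [hconst t ht, ← hint]
    simp
  · intro hL t ht
    set L := metricLength 𝔤
    have hg := h𝔤τ t ht
    have hs : 0 < √(𝔤 (τ t)) := Real.sqrt_pos.2 hg
    have h1 : HasDerivWithinAt (fun u => 2 * L * √(𝔤 (τ u)))
        (derivWithin τ (Icc (0 : ℝ) 1) t ^ 2 * derivWithin 𝔤 (Icc 0 1) (τ t)) (Icc 0 1) t := by
      refine (((hcomp t ht).sqrt hg.ne').const_mul (2 * L)).congr_deriv ?_
      rw [← hL t ht, metricSpeed]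
      field_simp
    refine h1.congr_of_mem (fun u hu' => ?_) ht
    rw [← hL u hu', metricSpeed]
    have h2 := Real.mul_self_sqrt (h𝔤τ u hu').le
    calc 2 * derivWithin τ (Icc (0 : ℝ) 1) u * 𝔤 (τ u)
        = 2 * derivWithin τ (Icc (0 : ℝ) 1) u * (√(𝔤 (τ u)) * √(𝔤 (τ u))) := by rw [h2]
      _ = _ := by ring

/-- The energy functional has a unique minimizer among the reparameterizations, which is also the
unique solution of the Euler-Lagrange equation. -/
theorem exists_minimizer_functional (hr : 1 ≤ r) (h𝔤 : ContDiffOn ℝ r 𝔤 (Icc 0 1))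
    (hpos : ∀ x ∈ Icc (0 : ℝ) 1, 0 < 𝔤 x) :
    ∃ τ₂ ∈ TRG r, ∀ τ ∈ TRG r,
      (EulerLagrange (reparamIntegrand 𝔤) τ ↔ EqOn τ τ₂ (Icc (0 : ℝ) 1)) ∧
      (IsGlobalMinimizer (functional (reparamIntegrand 𝔤)) (TRG r) τ ↔
        EqOn τ τ₂ (Icc (0 : ℝ) 1)) := by
  obtain ⟨τ₂, hτ₂, huniq⟩ := exists_constant_speed hr h𝔤 hpos
  have hc := h𝔤.continuousOn
  refine ⟨τ₂, hτ₂, fun τ hτ =>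
    ⟨(eulerLagrange_iff_metricSpeed hr h𝔤 hpos hτ).trans (huniq τ hτ), ?_⟩⟩
  rw [← huniq τ hτ, ← functional_eq_sq_iff hr hc hpos hτ]
  have hmin := (functional_eq_sq_iff hr hc hpos hτ₂).2 ((huniq τ₂ hτ₂).2 fun _ _ => rfl)
  constructor
  · intro h
    exact le_antisymm ((h.2 τ₂ hτ₂).trans hmin.le) (sq_metricLength_le_functional hr hc hpos hτ)
  · intro h
    exact ⟨hτ, fun τ' hτ' => h.trans_le (sq_metricLength_le_functional hr hc hpos hτ')⟩

end Reparameterization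

end Reparam

/-! ### The lower bound for the joint cost -/

namespace Reparam

open Filter Topology

section Coefficients

theorem contDiffOn_det {N : ℕ} {r : ℕ∞ω} {s : Set ℝ} {M : ℝ → Matrix (Fin N) (Fin N) ℝ}
    (hM : ∀ i j, ContDiffOn ℝ r (fun x => M x i j) s) : ContDiffOn ℝ r (fun x => (M x).det) s := by
  simp only [Matrix.det_apply']
  exact ContDiffOn.sum fun σ _ => contDiffOn_const.mul (contDiffOn_prod fun i _ => hM _ _)

/-- Solutions of linear systems depend smoothly on the coefficients, by Cramer's rule. -/
theorem contDiffOn_inv_mulVec {N : ℕ} {r : ℕ∞ω} {s : Set ℝ} {M : ℝ → Matrix (Fin N) (Fin N) ℝ}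
    {b : ℝ → Fin N → ℝ} (hM : ∀ i j, ContDiffOn ℝ r (fun x => M x i j) s)
    (hb : ∀ i, ContDiffOn ℝ r (fun x => b x i) s) (hdet : ∀ x ∈ s, IsUnit (M x).det) (k : Fin N) :
    ContDiffOn ℝ r (fun x => ((M x)⁻¹ *ᵥ b x) k) s := by
  have h1 : ∀ x, ((M x)⁻¹ *ᵥ b x) k = (M x).det⁻¹ * ((M x).updateCol k (b x)).det := by
    intro x
    rw [Matrix.inv_def, Matrix.smul_mulVec, ← Matrix.cramer_eq_adjugate_mulVec, Pi.smul_apply,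
      Matrix.cramer_apply, Ring.inverse_eq_inv', smul_eq_mul]
  simp_rw [h1]
  refine ((contDiffOn_det hM).inv fun x hx => (hdet x hx).ne_zero).mul (contDiffOn_det fun i j => ?_)
  simp only [Matrix.updateCol_apply]
  split_ifs
  · exact hb i
  · exact hM i j

variable {V : Type*} [NormedAddCommGroup V] [NormedSpace ℝ V]
  {G : Type*} [TopologicalSpace G] [ChartedSpace V G] [Group G]
  {n N : ℕ} [MulAction G (EuclideanSpace ℝ (Fin n))]
  {E : Module.Basis (Fin N) ℝ (GroupLieAlgebra 𝓘(ℝ, V) G)}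
  {h : EuclideanSpace ℝ (Fin n) → ℝ → ℝ}

theorem posSemidef_coeffM {s : ℝ}
    (hspace : ∀ i, MemLp (fun y => spaceDeriv h (E i) y s) 2 volume) :
    (coeffM h E s).PosSemidef :=
  posSemidef_gram hspace

theorem contDiffOn_xiStar {r : ℕ∞}
    (hM : ∀ i j, ContDiffOn ℝ r (fun s => coeffM h E s i j) (Icc (0 : ℝ) 1))
    (hb : ∀ i, ContDiffOn ℝ r (fun s => coeffB h E s i) (Icc (0 : ℝ) 1))
    (hMinv : ∀ s ∈ Icc (0 : ℝ) 1, IsUnit (coeffM h E s).det) :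
    ContDiffOn ℝ r (F := V) (fun s => xiStar h E s) (Icc (0 : ℝ) 1) := by
  have h1 := contDiffOn_inv_mulVec hM hb hMinv
  have gen : ∀ F : Fin N → V, ContDiffOn ℝ r
      (fun s => ∑ k, ((coeffM h E s)⁻¹ *ᵥ coeffB h E s) k • F k) (Icc (0 : ℝ) 1) :=
    fun F => ContDiffOn.sum fun k _ => (h1 k).smul contDiffOn_const
  exact gen E

theorem contDiffOn_frakG {r : ℕ∞}
    (hM : ∀ i j, ContDiffOn ℝ r (fun s => coeffM h E s i j) (Icc (0 : ℝ) 1))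
    (hb : ∀ i, ContDiffOn ℝ r (fun s => coeffB h E s i) (Icc (0 : ℝ) 1))
    (hc : ContDiffOn ℝ r (fun s => coeffC h s) (Icc (0 : ℝ) 1))
    (hMinv : ∀ s ∈ Icc (0 : ℝ) 1, IsUnit (coeffM h E s).det) :
    ContDiffOn ℝ r (frakG h E) (Icc (0 : ℝ) 1) := by
  have h1 := contDiffOn_inv_mulVec hM hb hMinv
  exact contDiffOn_const.mul (hc.sub (ContDiffOn.sum fun k _ => (hb k).mul (h1 k)))

/-- The coordinates of the deviation `ξ - a ξ*(s)` of a body velocity `ξ` from the optimal one at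
speed `a`. -/
def velocityGap (h : EuclideanSpace ℝ (Fin n) → ℝ → ℝ)
    (E : Module.Basis (Fin N) ℝ (GroupLieAlgebra 𝓘(ℝ, V) G))
    (v : GroupLieAlgebra 𝓘(ℝ, V) G) (a s : ℝ) : Fin N → ℝ :=
  ⇑(E.repr v) - a • ((coeffM h E s)⁻¹ *ᵥ coeffB h E s)

theorem velocityGap_eq_zero_iff (v : GroupLieAlgebra 𝓘(ℝ, V) G) (a s : ℝ) :
    velocityGap h E v a s = 0 ↔ v = a • xiStar h E s := by
  rw [velocityGap, sub_eq_zero]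
  constructor
  · intro h1
    rw [← E.sum_repr v, xiStar, Finset.smul_sum]
    refine Finset.sum_congr rfl fun k _ => ?_
    rw [h1, smul_smul]
    rfl
  · rintro rfl
    ext k
    simp [xiStar, Finsupp.single_apply]

/-- The rate of the joint cost at one time: a positive semidefinite quadratic form in the deviation
of the velocity from `τ' ξ*`, plus the integrand of the reparameterization problem. -/
theorem lintegral_rate [LieGroup 𝓘(ℝ, V) ∞ G]
    [ContMDiffSMul 𝓘(ℝ, V) 𝓘(ℝ, EuclideanSpace ℝ (Fin n)) ∞ G (EuclideanSpace ℝ (Fin n))]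
    (hΔ : ∀ (g : G) (y : EuclideanSpace ℝ (Fin n)), jacobian g y = 1)
    (hdiff : DifferentiableOn ℝ (Function.uncurry h) (univ ×ˢ Icc (0 : ℝ) 1))
    (hspace : ∀ s ∈ Icc (0 : ℝ) 1, ∀ i, MemLp (fun y => spaceDeriv h (E i) y s) 2 volume)
    (htime : ∀ s ∈ Icc (0 : ℝ) 1, MemLp (fun y => timeDeriv h y s) 2 volume)
    (hMinv : ∀ s ∈ Icc (0 : ℝ) 1, IsUnit (coeffM h E s).det)
    {g : ℝ → G} {ξ : ℝ → GroupLieAlgebra 𝓘(ℝ, V) G} (hg : HasBodyVelocity g ξ)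
    {τ : ℝ → ℝ} {τ' t : ℝ} (ht : t ∈ Icc (0 : ℝ) 1) (hτ : HasDerivWithinAt τ τ' (Icc 0 1) t)
    (hτm : MapsTo τ (Icc 0 1) (Icc 0 1)) :
    ∫⁻ x : EuclideanSpace ℝ (Fin n), ENNReal.ofReal
      (|derivWithin (fun u => h ((g u)⁻¹ • x) (τ u)) (Icc (0 : ℝ) 1) t| ^ 2) =
    ENNReal.ofReal (velocityGap h E (ξ t) τ' (τ t) ⬝ᵥ
      (coeffM h E (τ t) *ᵥ velocityGap h E (ξ t) τ' (τ t)) +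
        2 * reparamIntegrand (frakG h E) (τ t) τ') := by
  have hs := hτm ht
  set c : Fin N → ℝ := ⇑(E.repr (ξ t))
  have h1 : ∀ x : EuclideanSpace ℝ (Fin n),
      derivWithin (fun u => h ((g u)⁻¹ • x) (τ u)) (Icc (0 : ℝ) 1) t =
      (fun y => -(∑ i, c i * spaceDeriv h (E i) y (τ t)) + τ' * timeDeriv h y (τ t))
        ((g t)⁻¹ • x) := by
    intro x
    rw [derivWithin_comp_curve hdiff ht
      (HasBodyVelocityOn.hasDerivWithinAt_inv_smul (s := Icc (0 : ℝ) 1) hg x ht) hτ hτm]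
    have h2 := spaceDeriv_sum h E c ((g t)⁻¹ • x) (τ t)
    rw [E.sum_repr] at h2
    rw [map_neg]
    change -(spaceDeriv h (ξ t) ((g t)⁻¹ • x) (τ t)) + _ = _
    rw [h2]
  simp_rw [h1]
  rw [lintegral_inv_smul (V := V) hΔ (g t) (fun y => ENNReal.ofReal
    (|-(∑ i, c i * spaceDeriv h (E i) y (τ t)) + τ' * timeDeriv h y (τ t)| ^ 2)),
    lintegral_ofReal_sq_sub (hspace _ hs) (htime _ hs)]
  have h3 := quadratic_complete_square (M := coeffM h E (τ t))
    (by simpa using! (posSemidef_coeffM (hspace _ hs)).isHermitian) (hMinv _ hs) (coeffB h E (τ t)) c τ'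
    (coeffC h (τ t))
  have h4 : 2 * reparamIntegrand (frakG h E) (τ t) τ' = τ' ^ 2 * (coeffC h (τ t) -
      coeffB h E (τ t) ⬝ᵥ ((coeffM h E (τ t))⁻¹ *ᵥ coeffB h E (τ t))) := by
    rw [reparamIntegrand, frakG]
    ring
  rw [h4]
  exact congrArg ENNReal.ofReal h3

variable {r : ℕ∞}

/-- The joint cost is bounded below by the reparameterization functional, with equality exactly
for the curves that have the velocity `τ' ξ*(τ)`. -/
theorem costC₂_bound [FiniteDimensional ℝ V] [LieGroup 𝓘(ℝ, V) ∞ G]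
    [ContMDiffSMul 𝓘(ℝ, V) 𝓘(ℝ, EuclideanSpace ℝ (Fin n)) ∞ G (EuclideanSpace ℝ (Fin n))]
    (hΔ : ∀ (g : G) (y : EuclideanSpace ℝ (Fin n)), jacobian g y = 1) (hr : 1 ≤ r)
    (hdiff : DifferentiableOn ℝ (Function.uncurry h) (univ ×ˢ Icc (0 : ℝ) 1))
    (hspace : ∀ s ∈ Icc (0 : ℝ) 1, ∀ i, MemLp (fun y => spaceDeriv h (E i) y s) 2 volume)
    (htime : ∀ s ∈ Icc (0 : ℝ) 1, MemLp (fun y => timeDeriv h y s) 2 volume)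
    (hM : ∀ i j, ContDiffOn ℝ r (fun s => coeffM h E s i j) (Icc (0 : ℝ) 1))
    (hb : ∀ i, ContDiffOn ℝ r (fun s => coeffB h E s i) (Icc (0 : ℝ) 1))
    (hc : ContDiffOn ℝ r (fun s => coeffC h s) (Icc (0 : ℝ) 1))
    (hMinv : ∀ s ∈ Icc (0 : ℝ) 1, IsUnit (coeffM h E s).det)
    (hpos : ∀ s ∈ Icc (0 : ℝ) 1, 0 < frakG h E s)
    {g : ℝ → G} (hg : g ∈ groupCurves V G r) {τ : ℝ → ℝ} (hτ : τ ∈ TRG r) :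
    ENNReal.ofReal (functional (reparamIntegrand (frakG h E)) τ) ≤ costC₂ h g τ ∧
    (costC₂ h g τ = ENNReal.ofReal (functional (reparamIntegrand (frakG h E)) τ) ↔
      HasBodyVelocity g fun t => derivWithin τ (Icc (0 : ℝ) 1) t • xiStar h E (τ t)) := by
  obtain ⟨ξ, hξc, hξ⟩ := exists_continuous_bodyVelocity
    (ContMDiffOn.of_le (show ContMDiffOn 𝓘(ℝ, ℝ) 𝓘(ℝ, V) r g (Icc (0 : ℝ) 1) from hg)
      (by exact_mod_cast hr))
  have hτm := TRG.mapsTo hτ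
  have hτc := hτ.1.continuousOn
  have hτ'c := TRG.continuousOn_derivWithin hr hτ
  set gap : ℝ → Fin N → ℝ := fun t => velocityGap h E (ξ t) (derivWithin τ (Icc (0 : ℝ) 1) t) (τ t)
  set A : ℝ → ℝ := fun t => gap t ⬝ᵥ (coeffM h E (τ t) *ᵥ gap t)
  set f : ℝ → ℝ := fun t => reparamIntegrand (frakG h E) (τ t) (derivWithin τ (Icc (0 : ℝ) 1) t)
  have hpsd : ∀ t ∈ Icc (0 : ℝ) 1, (coeffM h E (τ t)).PosSemidef :=
    fun t ht => posSemidef_coeffM (hspace _ (hτm ht))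
  have hA0 : ∀ t ∈ Icc (0 : ℝ) 1, 0 ≤ A t := fun t ht => by
    simpa using (hpsd t ht).dotProduct_mulVec_nonneg (gap t)
  have hAiff : ∀ t ∈ Icc (0 : ℝ) 1,
      (A t = 0 ↔ (ξ t : GroupLieAlgebra 𝓘(ℝ, V) G) =
        derivWithin τ (Icc (0 : ℝ) 1) t • xiStar h E (τ t)) := by
    intro t ht
    refine Iff.trans ?_ (velocityGap_eq_zero_iff (h := h) (E := E) (ξ t) _ _)
    have h1 := (hpsd t ht).dotProduct_mulVec_zero_iff (gap t)
    rw [star_trivial] at h1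
    refine h1.trans ⟨fun h2 => ?_, fun h2 => ?_⟩
    · exact Matrix.mulVec_injective_iff_isUnit.2
        ((Matrix.isUnit_iff_isUnit_det _).2 (hMinv _ (hτm ht))) (h2.trans (Matrix.mulVec_zero _).symm)
    · exact (congrArg _ h2).trans (Matrix.mulVec_zero _)
  have hf0 : ∀ t ∈ Icc (0 : ℝ) 1, 0 ≤ f t := fun t ht =>
    mul_nonneg (sq_nonneg _) (hpos _ (hτm ht)).le
  have hfc : ContinuousOn f (Icc 0 1) :=
    (hτ'c.pow 2).mul ((contDiffOn_frakG hM hb hc hMinv).continuousOn.comp hτc hτm)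
  have hgapc : ∀ i, ContinuousOn (fun t => gap t i) (Icc 0 1) := by
    intro i
    have h1 : ContinuousOn (fun t => E.repr (ξ t) i) (Icc 0 1) := by
      have gen : ∀ L : V →ₗ[ℝ] ℝ, ContinuousOn (fun t => L (ξ t)) (Icc 0 1) :=
        fun L => L.continuous_of_finiteDimensional.comp_continuousOn hξc
      exact gen (E.coord i)
    exact h1.sub (hτ'c.mul ((contDiffOn_inv_mulVec hM hb hMinv i).continuousOn.comp hτc hτm))
  have hAc : ContinuousOn A (Icc 0 1) := by
    refine continuousOn_finsetSum _ fun i _ => (hgapc i).mul ?_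
    change ContinuousOn (fun t => ∑ j, coeffM h E (τ t) i j * gap t j) (Icc 0 1)
    exact continuousOn_finsetSum _ fun j _ =>
      ((hM i j).continuousOn.comp hτc hτm).mul (hgapc j)
  have hcost : costC₂ h g τ = (1 / 2) * (∫⁻ t in Icc (0 : ℝ) 1, ENNReal.ofReal (A t)) +
      ENNReal.ofReal (functional (reparamIntegrand (frakG h E)) τ) := by
    have h1 : ∫⁻ t in Icc (0 : ℝ) 1, ∫⁻ x : EuclideanSpace ℝ (Fin n), ENNReal.ofReal
        (|derivWithin (fun u => h ((g u)⁻¹ • x) (τ u)) (Icc (0 : ℝ) 1) t| ^ 2) =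
        ∫⁻ t in Icc (0 : ℝ) 1, (ENNReal.ofReal (A t) + 2 * ENNReal.ofReal (f t)) := by
      refine setLIntegral_congr_fun measurableSet_Icc fun t ht => ?_
      rw [lintegral_rate hΔ hdiff hspace htime hMinv hξ ht (TRG.hasDerivWithinAt hr hτ ht) hτm,
        ENNReal.ofReal_add (hA0 t ht) (mul_nonneg zero_le_two (hf0 t ht)),
        ENNReal.ofReal_mul zero_le_two, ENNReal.ofReal_ofNat]
    have hfm : AEMeasurable f (volume.restrict (Icc 0 1)) := hfc.aemeasurable measurableSet_Icc
    have h2 : ∫⁻ t in Icc (0 : ℝ) 1, ENNReal.ofReal (f t) =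
        ENNReal.ofReal (functional (reparamIntegrand (frakG h E)) τ) := by
      rw [← ofReal_integral_eq_lintegral_ofReal (hfc.integrableOn_Icc)
        ((ae_restrict_iff' measurableSet_Icc).2 (ae_of_all _ hf0)), integral_Icc_eq_integral_Ioc,
        ← intervalIntegral.integral_of_le zero_le_one]
      rfl
    rw [costC₂, h1, lintegral_add_right' _ (hfm.ennreal_ofReal.const_mul 2),
      lintegral_const_mul'' _ hfm.ennreal_ofReal, h2, mul_add, ← mul_assoc]
    congr 1
    rw [one_div, ENNReal.inv_mul_cancel two_ne_zero ENNReal.ofNat_ne_top, one_mul]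
  have hAm : AEMeasurable A (volume.restrict (Icc 0 1)) := hAc.aemeasurable measurableSet_Icc
  refine ⟨hcost ▸ le_add_self, ?_⟩
  have h3 : costC₂ h g τ = ENNReal.ofReal (functional (reparamIntegrand (frakG h E)) τ) ↔
      ∀ t ∈ Icc (0 : ℝ) 1, A t = 0 := by
    have hcancel : ∀ a b : ℝ≥0∞, b ≠ ⊤ → (a + b = b ↔ a = 0) := fun a b hb => by
      simpa using ENNReal.add_left_inj (b := a) (c := 0) hb
    rw [hcost, hcancel _ _ ENNReal.ofReal_ne_top, mul_eq_zero,
      or_iff_right (by simp), lintegral_eq_zero_iff' hAm.ennreal_ofReal]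
    constructor
    · intro h4
      have h5 : A =ᵐ[volume.restrict (Icc 0 1)] fun _ => 0 := by
        filter_upwards [h4, ae_restrict_mem measurableSet_Icc] with t ht ht'
        exact le_antisymm (ENNReal.ofReal_eq_zero.1 ht) (hA0 t ht')
      exact Measure.eqOn_Icc_of_ae_eq volume zero_ne_one h5 hAc continuousOn_const
    · intro h4
      filter_upwards [ae_restrict_mem measurableSet_Icc] with t ht
      simp [h4 t ht]
  rw [h3]
  constructor
  · intro h4
    exact HasBodyVelocityOn.congr hξ fun t ht => (hAiff t ht).1 (h4 t ht)
  · intro h4 t ht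
    refine (hAiff t ht).2 ?_
    have h5 := ((hasMFDerivWithinAt_iff_chart (g t) ht (mem_chart_source V (g t))).1 (hξ t ht)).2
    have h6 := ((hasMFDerivWithinAt_iff_chart (g t) ht (mem_chart_source V (g t))).1 (h4 t ht)).2
    have hu := uniqueDiffOn_Icc (zero_lt_one (α := ℝ)) t ht
    exact (chartField_bijective (g t) (g t) (mem_chart_source V (g t))).injective
      ((h5.derivWithin hu).symm.trans (h6.derivWithin hu))

end Coefficients

end Reparam

end

/-! ### The equivalence of the two minimization problems -/

theorem theorem3
    {V : Type*} [NormedAddCommGroup V] [NormedSpace ℝ V] [FiniteDimensional ℝ V]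
    {G : Type*} [TopologicalSpace G] [T2Space G] [ChartedSpace V G] [Group G]
    [LieGroup 𝓘(ℝ, V) ∞ G]
    {n N : ℕ} [MulAction G (EuclideanSpace ℝ (Fin n))]
    -- the action of `G` on `ℝⁿ` is smooth and has unit Jacobian
    [ContMDiffSMul 𝓘(ℝ, V) 𝓘(ℝ, EuclideanSpace ℝ (Fin n)) ∞ G (EuclideanSpace ℝ (Fin n))]
    (hΔ : ∀ (g : G) (y : EuclideanSpace ℝ (Fin n)), Reparam.jacobian g y = 1)
    (E : Module.Basis (Fin N) ℝ (GroupLieAlgebra 𝓘(ℝ, V) G))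
    (r : ℕ∞) (hr : 1 ≤ r)
    -- the signal, for which `M`, `b`, `c` are well defined and of class `C^r`
    (h : EuclideanSpace ℝ (Fin n) → ℝ → ℝ)
    (hdiff : DifferentiableOn ℝ (Function.uncurry h) (univ ×ˢ Icc (0 : ℝ) 1))
    (hspace : ∀ s ∈ Icc (0 : ℝ) 1, ∀ i,
      MemLp (fun y => Reparam.spaceDeriv h (E i) y s) 2 volume)
    (htime : ∀ s ∈ Icc (0 : ℝ) 1, MemLp (fun y => Reparam.timeDeriv h y s) 2 volume)
    (hM : ∀ i j, ContDiffOn ℝ r (fun s => Reparam.coeffM h E s i j) (Icc (0 : ℝ) 1))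
    (hb : ∀ i, ContDiffOn ℝ r (fun s => Reparam.coeffB h E s i) (Icc (0 : ℝ) 1))
    (hc : ContDiffOn ℝ r (fun s => Reparam.coeffC h s) (Icc (0 : ℝ) 1))
    -- `M` is invertible, and `𝔤₂` is positive
    (hMinv : ∀ s ∈ Icc (0 : ℝ) 1, IsUnit (Reparam.coeffM h E s).det)
    (hpos : ∀ s ∈ Icc (0 : ℝ) 1, 0 < Reparam.frakG h E s) :
    -- the problem over `G`: the minimizers are the curves with body velocity `ξ* = M⁻¹ b`,
    -- and there is exactly one for each starting point
    (∀ g ∈ Reparam.groupCurves V G r,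
      Reparam.IsGlobalMinimizer (Reparam.costC₁ h) (Reparam.groupCurves V G r) g ↔
        Reparam.HasBodyVelocity g (Reparam.xiStar h E)) ∧
    (∀ g₀ : G, ∃ g₁ : ℝ → G, g₁ 0 = g₀ ∧
      Reparam.IsGlobalMinimizer (Reparam.costC₁ h) (Reparam.groupCurves V G r) g₁ ∧
      ∀ g : ℝ → G, g 0 = g₀ →
        Reparam.IsGlobalMinimizer (Reparam.costC₁ h) (Reparam.groupCurves V G r) g →
        EqOn g g₁ (Icc (0 : ℝ) 1)) ∧
    -- inserting a solution of the problem over `G` leaves the reparameterization problem for `𝔤₂`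
    (∀ g₁ : ℝ → G,
      Reparam.IsGlobalMinimizer (Reparam.costC₁ h) (Reparam.groupCurves V G r) g₁ →
      ∀ τ ∈ Reparam.TRG r, Reparam.costC₂ h (g₁ ∘ τ) τ =
        ENNReal.ofReal
          (Reparam.functional (Reparam.reparamIntegrand (Reparam.frakG h E)) τ)) ∧
    -- whose unique minimizer is the unique solution of the Euler-Lagrange equation
    (∃ τ₂ ∈ Reparam.TRG r, ∀ τ ∈ Reparam.TRG r,
      (Reparam.EulerLagrange (Reparam.reparamIntegrand (Reparam.frakG h E)) τ ↔
        EqOn τ τ₂ (Icc (0 : ℝ) 1)) ∧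
      (Reparam.IsGlobalMinimizer
          (Reparam.functional (Reparam.reparamIntegrand (Reparam.frakG h E)))
          (Reparam.TRG r) τ ↔
        EqOn τ τ₂ (Icc (0 : ℝ) 1))) ∧
    -- the joint problem is equivalent to solving these two problems one after the other
    (∀ (g : ℝ → G) (τ : ℝ → ℝ),
      Reparam.IsGlobalMinimizer (fun p : (ℝ → G) × (ℝ → ℝ) => Reparam.costC₂ h p.1 p.2)
          (Reparam.groupCurves V G r ×ˢ Reparam.TRG r) (g, τ) ↔
        Reparam.IsGlobalMinimizer
          (Reparam.functional (Reparam.reparamIntegrand (Reparam.frakG h E)))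
          (Reparam.TRG r) τ ∧
        ∃ g₁ : ℝ → G,
          Reparam.IsGlobalMinimizer (Reparam.costC₁ h) (Reparam.groupCurves V G r) g₁ ∧
          EqOn g (g₁ ∘ τ) (Icc (0 : ℝ) 1)) := by
  have hur := fun τ (hτ : τ ∈ Reparam.TRG r) t (ht : t ∈ Icc (0 : ℝ) 1) =>
    Reparam.TRG.hasDerivWithinAt hr hτ ht
  have hξ := Reparam.contDiffOn_xiStar hM hb hMinv
  have hg𝔤 := Reparam.contDiffOn_frakG hM hb hc hMinv
  have hcomplete : CompleteSpace V := FiniteDimensional.complete ℝ V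
  have hbound := fun (g : ℝ → G) (hg : g ∈ Reparam.groupCurves V G r) (τ : ℝ → ℝ)
    (hτ : τ ∈ Reparam.TRG r) =>
    Reparam.costC₂_bound hΔ hr hdiff hspace htime hM hb hc hMinv hpos hg hτ
  set J := Reparam.functional (Reparam.reparamIntegrand (Reparam.frakG h E)) with hJ
  have hJ0 : ∀ τ ∈ Reparam.TRG r, 0 ≤ J τ := fun τ hτ =>
    (sq_nonneg _).trans (Reparam.sq_metricLength_le_functional hr hg𝔤.continuousOn hpos hτ)
  -- `C₁` is the joint cost of the identity reparameterization
  have hid := Reparam.id_mem_TRG r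
  have hvel_id : ∀ g : ℝ → G, Reparam.HasBodyVelocity g (fun t =>
      derivWithin (fun t : ℝ => t) (Icc (0 : ℝ) 1) t • Reparam.xiStar h E t) ↔
      Reparam.HasBodyVelocity g (Reparam.xiStar h E) := by
    intro g
    have h1 : ∀ t ∈ Icc (0 : ℝ) 1, derivWithin (fun t : ℝ => t) (Icc (0 : ℝ) 1) t •
        Reparam.xiStar h E t = Reparam.xiStar h E t := fun t ht => by
      rw [derivWithin_id' t _ (uniqueDiffOn_Icc zero_lt_one t ht), one_smul]
    exact ⟨fun h2 => Reparam.HasBodyVelocityOn.congr h2 h1,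
      fun h2 => Reparam.HasBodyVelocityOn.congr h2 fun t ht => (h1 t ht).symm⟩
  have hexists : ∀ g₀ : G, ∃ g₁ ∈ Reparam.groupCurves V G r, g₁ 0 = g₀ ∧
      Reparam.HasBodyVelocity g₁ (Reparam.xiStar h E) := by
    intro g₀
    obtain ⟨g₁, h1, h2⟩ := Reparam.exists_curve hξ.continuousOn g₀
    exact ⟨g₁, h2.contMDiffOn hξ, h1, h2⟩
  have hC₁ : ∀ g ∈ Reparam.groupCurves V G r,
      (Reparam.IsGlobalMinimizer (Reparam.costC₁ h) (Reparam.groupCurves V G r) g ↔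
        Reparam.HasBodyVelocity g (Reparam.xiStar h E)) := by
    intro g hg
    rw [← hvel_id g]
    refine Iff.trans ?_ (hbound g hg _ hid).2
    constructor
    · intro hmin
      obtain ⟨g₁, hg₁, -, hv⟩ := hexists 1
      exact le_antisymm ((hmin.2 g₁ hg₁).trans
        ((hbound g₁ hg₁ _ hid).2.2 ((hvel_id g₁).2 hv)).le) (hbound g hg _ hid).1
    · intro heq
      exact ⟨hg, fun g' hg' => heq.le.trans (hbound g' hg' _ hid).1⟩
  have hcomp : ∀ g₁ ∈ Reparam.groupCurves V G r, ∀ τ ∈ Reparam.TRG r,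
      Reparam.HasBodyVelocity g₁ (Reparam.xiStar h E) →
      g₁ ∘ τ ∈ Reparam.groupCurves V G r ∧
        Reparam.costC₂ h (g₁ ∘ τ) τ = ENNReal.ofReal (J τ) := by
    intro g₁ hg₁ τ hτ hv
    have hm : g₁ ∘ τ ∈ Reparam.groupCurves V G r :=
      ContMDiffOn.comp hg₁ hτ.1.contMDiffOn (Reparam.TRG.mapsTo hτ)
    exact ⟨hm, (hbound _ hm τ hτ).2.2
      (Reparam.HasBodyVelocityOn.comp_real hv (Reparam.TRG.mapsTo hτ) (hur τ hτ))⟩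
  obtain ⟨τ₂, hτ₂, hτ₂'⟩ := Reparam.exists_minimizer_functional hr hg𝔤 hpos
  refine ⟨hC₁, fun g₀ => ?_, fun g₁ hg₁ τ hτ => ?_, ⟨τ₂, hτ₂, hτ₂'⟩, fun g τ => ⟨fun hmin => ?_, ?_⟩⟩
  · obtain ⟨g₁, hg₁, h0, hv⟩ := hexists g₀
    refine ⟨g₁, h0, (hC₁ g₁ hg₁).2 hv, fun g hg0 hg => ?_⟩
    exact Reparam.HasBodyVelocityOn.eqOn hξ.continuousOn ((hC₁ g hg.1).1 hg) hv (hg0.trans h0.symm)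
  · exact (hcomp g₁ hg₁.1 τ hτ ((hC₁ g₁ hg₁.1).1 hg₁)).2
  · obtain ⟨⟨hg, hτ⟩, hle⟩ := hmin
    have hg : g ∈ Reparam.groupCurves V G r := hg
    have hτ : τ ∈ Reparam.TRG r := hτ
    obtain ⟨k, hk, -, hkv⟩ := hexists 1
    -- every competitor `τ'` for `J` gives the competitor `(k ∘ τ', τ')` for the joint cost
    have hle' : ∀ τ' ∈ Reparam.TRG r,
        Reparam.costC₂ h g τ ≤ ENNReal.ofReal (J τ') := fun τ' hτ' =>
      (hle (k ∘ τ', τ') ⟨(hcomp k hk τ' hτ' hkv).1, hτ'⟩).trans (hcomp k hk τ' hτ' hkv).2.le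
    have hlow := hbound g hg τ hτ
    refine ⟨⟨hτ, fun τ' hτ' => (ENNReal.ofReal_le_ofReal_iff (hJ0 τ' hτ')).1
      (hlow.1.trans (hle' τ' hτ'))⟩, ?_⟩
    have hv := hlow.2.1 (le_antisymm (hle' τ hτ) hlow.1)
    obtain ⟨k₁, hk₁, hk₁0, hk₁v⟩ := hexists (g 0)
    refine ⟨k₁, (hC₁ k₁ hk₁).2 hk₁v, ?_⟩
    -- both sides have velocity `τ' ξ*(τ)` and start at `g 0`
    have hcont : ∀ η : ℝ → V, ContinuousOn η (Icc 0 1) →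
        ContinuousOn (fun t => derivWithin τ (Icc (0 : ℝ) 1) t • η (τ t)) (Icc 0 1) := fun η hη =>
      (Reparam.TRG.continuousOn_derivWithin hr hτ).smul
        (hη.comp hτ.1.continuousOn (Reparam.TRG.mapsTo hτ))
    exact Reparam.HasBodyVelocityOn.eqOn (hcont _ hξ.continuousOn) hv
      (Reparam.HasBodyVelocityOn.comp_real hk₁v (Reparam.TRG.mapsTo hτ) (hur τ hτ))
      (by rw [Function.comp_apply, hτ.2.2.1, hk₁0])
  · rintro ⟨hτ, g₁, hg₁, heq⟩
    have hv := (hC₁ g₁ hg₁.1).1 hg₁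
    obtain ⟨hm, hcost⟩ := hcomp g₁ hg₁.1 τ hτ.1 hv
    have hg : g ∈ Reparam.groupCurves V G r := ContMDiffOn.congr hm heq
    have hcost' : Reparam.costC₂ h g τ = ENNReal.ofReal (J τ) :=
      (hbound g hg τ hτ.1).2.2 (Reparam.HasBodyVelocityOn.congr_curve
        (Reparam.HasBodyVelocityOn.comp_real hv (Reparam.TRG.mapsTo hτ.1) (hur τ hτ.1)) heq)
    refine ⟨⟨hg, hτ.1⟩, fun p hp => ?_⟩
    exact hcost'.le.trans ((ENNReal.ofReal_le_ofReal (hτ.2 p.2 hp.2)).trans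
      (hbound p.1 hp.1 p.2 hp.2).1)
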